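/- Let $F$ be a non-archimedean local field of characteristic zero with ring of integers $\mathfrak o$, maximal ideal $\mathfrak p$, a uniformizer $\varpi$, residue field of cardinality $q$, and normalized absolute value $|\cdot|$. Let $a,b\in\mathfrak o$, $c\in\mathfrak o^\times$ with $d=b^2-4ac\neq0$. Let $L=F(\sqrt d)$ if $d\notin F^{\times2}$ and $L=F\oplus F$ otherwise (with $F$ embedded diagonally and $\sqrt d$ read as $(\sqrt d,-\sqrt d)$). Assume that $d$ generates the discriminant of $L/F$ if $d\notin F^{\times 2}$, and that $d\in\mathfrak o^\times$ if $d\in F^{\times2}$. Let $\mathfrak o_L$ be the ring of integers of $L$ ($=\mathfrak o\oplus\mathfrak o$ if $L=F\oplus F$) and $\mathfrak P_L=\mathfrak p\,\mathfrak o_L$; if $L$ is a field, let $\varpi_L$ be a uniformizer of $L$. Put $$S=\begin{pmatrix}a&b/2\\b/2&c\end{pmatrix},\qquad \xi=\begin{pmatrix}b/2&c\\-a&-b/2\end{pmatrix},\qquad T=\{g\in \mathrm{GL}_2(F): {}^tgSg=\det(g)S\}=F(\xi)^\times,$$ and identify $T$ with $L^\times$ by $x+y\xi\mapsto x+y\sqrt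 d/2$. Let $\chi_1,\chi_2$ be unramified characters of $F^\times$ with $\chi_1\chi_2^{-1}\ne|\cdot|^{\pm1}$, let $\pi=\chi_1\times\chi_2$ be the (normalized) principal series representation of $\mathrm{GL}_2(F)$, with central character $\omega_\pi=\chi_1\chi_2$, and put $\lambda=q^{1/2}(\chi_1(\varpi)+\chi_2(\varpi))$. Let $\Omega$ be a character (continuous homomorphism to $\mathbb C^\times$) of $L^\times$ with $\Omega|_{F^\times}=\omega_\pi$, and let $$c(\Omega)=\min\{m\ge0:\ \Omega \text{ is trivial on }(1+\mathfrak P_L^m)\cap\mathfrak o_L^\times\}.$$ Let $\pi$ be given by an $(S,\Omega)$-Waldspurger model, that is, as a subrepresentation, isomorphic to $\chi_1\times\chi_2$, of the space of locally constant functions $B:\mathrm{GL}_2(F)\to\mathbb C$ with $B(tg)=\Omega(t)B(g)$ for all $t\in T$, $g\in\mathrm{GL}_2(F)$, on which $\mathrm{GL}_2(F)$ acts by right translation. Let $B_0$ be a spherical (right $\mathrm{GL}_2(\mathfrak o)$-invariant) vector in this model. Then, as formal power series over $\mathbb{C}$, $$\sum_{m\ge c(\Omega)}B_0\!\begin{pmatrix}\varpi^m&\\&1\end{pmatrix}x^m=\frac{(q-\kappa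 x)\,x^{c(\Omega)}}{\omega_\pi(\varpi)x^2-\lambda x+q}\;B_0\!\begin{pmatrix}\varpi^{c(\Omega)}&\\&1\end{pmatrix},$$ where $$\kappa=\begin{cases}0&\text{if }c(\Omega)>0,\\[2pt] \dfrac{\lambda}{q+1}&\text{if }c(\Omega)=0\text{ and }L/F\text{ is an unramified field extension},\\[4pt] \Omega(\varpi_L)&\text{if }c(\Omega)=0\text{ and }L/F\text{ is a ramified field extension},\\[2pt] -\dfrac{\lambda}{q-1}+\dfrac{q}{q-1}\bigl(\Omega(\varpi,1)+\Omega(1,\varpi)\bigr)&\text{if }c(\Omega)=0\text{ and }L=F\oplus F.\end{cases}$$ -/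

import Mathlib

open ValuativeRel
open scoped MatrixGroups

noncomputable section

namespace Waldspurger

/-- `u : Kˣ` comes from a prime (irreducible) element of the ring `R` contained in `K`.  For a
discrete valuation ring `R` with fraction field `K`, this says that `u` is a uniformizer. -/
def IsUniformizer (R : Type*) {K : Type*} [CommRing R] [CommRing K] [Algebra R K] (u : Kˣ) :
    Prop :=
  ∃ r : R, Irreducible r ∧ algebraMap R K r = (u : K)

section LocalField

variable (F : Type*) [Field F] [ValuativeRel F] [TopologicalSpace F] [IsNonarchimedeanLocalField F]

/-- The cardinality `q` of the residue field of `F`. -/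
def residueCard : ℕ := Nat.card 𝓀[F]

/-- The normalized absolute value on `Fˣ`: a uniformizer has absolute value `q⁻¹`.  Here
`valueGroupWithZeroIsoInt` is the (unique) isomorphism of ordered monoids between the value group
with zero of `F` and `ℤ ∪ {0}` (written multiplicatively), so that `WithZero.log` of the value
of `x` is `- v(x)`. -/
def normalizedAbs (x : Fˣ) : ℝ :=
  (residueCard F : ℝ) ^
    (WithZero.log (IsNonarchimedeanLocalField.valueGroupWithZeroIsoInt F (valuation F (x : F))))

variable {F}

/-- A character of `Fˣ` is unramified if it is trivial on the units of the ring of integers. -/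
def IsUnramifiedChar (χ : Fˣ →ₜ* ℂˣ) : Prop :=
  ∀ u : 𝒪[F]ˣ, χ (Units.map (algebraMap 𝒪[F] F).toMonoidHom u) = 1

end LocalField

section GL2

variable {F : Type*} [Field F]

/-- The upper triangular matrix with rows `(α, u)` and `(0, δ)`. -/
def upperTri (α δ : Fˣ) (u : F) : GL (Fin 2) F :=
  Matrix.GeneralLinearGroup.mkOfDetNeZero !![(α : F), u; 0, (δ : F)]
    (by simp [Matrix.det_fin_two_of])

/-- The matrix `diag(α, 1)`. -/
def diagOne (α : Fˣ) : GL (Fin 2) F := upperTri α 1 0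

/-- The right regular representation of `GL₂(F)` on all functions `GL₂(F) → ℂ`:
`(g · B)(h) = B(h g)`. -/
def rightRegular (F : Type*) [Field F] :
    Representation ℂ (GL (Fin 2) F) (GL (Fin 2) F → ℂ) where
  toFun g :=
    { toFun := fun B h => B (h * g)
      map_add' := fun _ _ => rfl
      map_smul' := fun _ _ => rfl }
  map_one' := by ext; simp
  map_mul' g g' := by ext; simp [mul_assoc]

/-- The symmetric matrix `S` with rows `(a, b/2)` and `(b/2, c)`. -/
def matS (a b c : F) : Matrix (Fin 2) (Fin 2) F := !![a, b / 2; b / 2, c]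

/-- The matrix `ξ` with rows `(b/2, c)` and `(-a, -b/2)`. -/
def matXi (a b c : F) : Matrix (Fin 2) (Fin 2) F := !![b / 2, c; -a, -b / 2]

/-- The torus `T(F) = {g ∈ GL₂(F) : ᵗg S g = det(g) S}`. -/
def torus (a b c : F) : Subgroup (GL (Fin 2) F) where
  carrier := {g | (g : Matrix (Fin 2) (Fin 2) F).transpose * matS a b c * g =
    (g : Matrix (Fin 2) (Fin 2) F).det • matS a b c}
  one_mem' := by simp
  mul_mem' := by
    intro g h hg hh
    simp only [Set.mem_ofPred_eq] at hg hh ⊢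
    calc (↑(g * h) : Matrix (Fin 2) (Fin 2) F).transpose * matS a b c *
          (↑(g * h) : Matrix (Fin 2) (Fin 2) F)
        = (h : Matrix (Fin 2) (Fin 2) F).transpose *
            ((g : Matrix (Fin 2) (Fin 2) F).transpose * matS a b c * g) * h := by
          simp only [Units.val_mul, Matrix.transpose_mul, Matrix.mul_assoc]
      _ = _ := by
          rw [hg, Matrix.mul_smul, Matrix.smul_mul, hh, smul_smul, Units.val_mul, Matrix.det_mul]
  inv_mem' := by
    intro g hg
    simp only [Set.mem_ofPred_eq] at hg ⊢
    have h1 : (g : Matrix (Fin 2) (Fin 2) F) * (↑g⁻¹ : Matrix (Fin 2) (Fin 2) F) = 1 := by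
      rw [← Units.val_mul, mul_inv_cancel, Units.val_one]
    have h2 : (↑g⁻¹ : Matrix (Fin 2) (Fin 2) F).transpose *
        (g : Matrix (Fin 2) (Fin 2) F).transpose = 1 := by
      rw [← Matrix.transpose_mul, h1, Matrix.transpose_one]
    have h3 : (g : Matrix (Fin 2) (Fin 2) F).det * (↑g⁻¹ : Matrix (Fin 2) (Fin 2) F).det = 1 := by
      rw [← Matrix.det_mul, h1, Matrix.det_one]
    have h4 : matS a b c = (g : Matrix (Fin 2) (Fin 2) F).det •
        ((↑g⁻¹ : Matrix (Fin 2) (Fin 2) F).transpose * matS a b c *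
          (↑g⁻¹ : Matrix (Fin 2) (Fin 2) F)) := by
      rw [← Matrix.smul_mul, ← Matrix.mul_smul, ← hg]
      have h5 : (↑g⁻¹ : Matrix (Fin 2) (Fin 2) F).transpose *
          ((g : Matrix (Fin 2) (Fin 2) F).transpose * matS a b c *
            (g : Matrix (Fin 2) (Fin 2) F)) * (↑g⁻¹ : Matrix (Fin 2) (Fin 2) F) =
          ((↑g⁻¹ : Matrix (Fin 2) (Fin 2) F).transpose *
            (g : Matrix (Fin 2) (Fin 2) F).transpose) * matS a b c *
            ((g : Matrix (Fin 2) (Fin 2) F) * (↑g⁻¹ : Matrix (Fin 2) (Fin 2) F)) := by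
        simp only [Matrix.mul_assoc]
      rw [h5, h1, h2, Matrix.one_mul, Matrix.mul_one]
    conv_rhs => rw [h4, smul_smul, mul_comm, h3, one_smul]

/-- `T(F) = F(ξ)ˣ`: the torus consists of the invertible matrices of the form `x + y ξ`. -/
theorem mem_torus_iff [CharZero F] {a b c : F} (hc : c ≠ 0) (g : GL (Fin 2) F) :
    g ∈ torus a b c ↔ ∃ x y : F, (g : Matrix (Fin 2) (Fin 2) F) =
      x • (1 : Matrix (Fin 2) (Fin 2) F) + y • matXi a b c := by
  have h2 : (2 : F) ≠ 0 := two_ne_zero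
  change (g : Matrix (Fin 2) (Fin 2) F).transpose * matS a b c * g =
    (g : Matrix (Fin 2) (Fin 2) F).det • matS a b c ↔ _
  have hdet : (g : Matrix (Fin 2) (Fin 2) F).det ≠ 0 :=
    ((Matrix.isUnit_iff_isUnit_det _).mp g.isUnit).ne_zero
  generalize (g : Matrix (Fin 2) (Fin 2) F) = M at *
  constructor
  · intro h
    have hS : matS a b c * M = M.adjugate.transpose * matS a b c := by
      have h1 : M.adjugate.transpose * (M.transpose * matS a b c * M) =
          M.det • (matS a b c * M) := by
        rw [Matrix.mul_assoc, ← Matrix.mul_assoc, ← Matrix.transpose_mul, Matrix.mul_adjugate]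
        simp
      rw [h, Matrix.mul_smul] at h1
      exact (smul_right_injective _ hdet h1).symm
    have e01 := congrFun (congrFun hS 0) 1
    have e11 := congrFun (congrFun hS 1) 1
    simp only [matS, Matrix.mul_apply, Fin.sum_univ_two, Matrix.adjugate_fin_two,
      Matrix.transpose_apply, Matrix.of_apply, Matrix.cons_val', Matrix.cons_val_zero,
      Matrix.cons_val_one, Matrix.cons_val_fin_one] at e01 e11
    refine ⟨(M 0 0 + M 1 1) / 2, M 0 1 / c, ?_⟩
    have k1 : M 0 0 * c - c * M 1 1 = b * M 0 1 := by linear_combination -e11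
    have k2 : M 1 0 * c = -(a * M 0 1) := by linear_combination e01
    ext i j
    fin_cases i <;> fin_cases j <;> simp [matXi] <;> field_simp
    · linear_combination k1
    · linear_combination k2
    · linear_combination -k1
  · rintro ⟨x, y, rfl⟩
    ext i j
    fin_cases i <;> fin_cases j <;>
      simp [matXi, matS, Matrix.mul_apply, Fin.sum_univ_two, Matrix.det_fin_two] <;> field_simp <;>
      ring

/-- The subgroup `K = GL₂(𝔬)` of `GL₂(F)`. -/
def maxCompact (F : Type*) [Field F] [ValuativeRel F] : Subgroup (GL (Fin 2) F) :=
  (Matrix.GeneralLinearGroup.map (n := Fin 2) (algebraMap 𝒪[F] F)).range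

/-- A function on `GL₂(F)` is spherical if it is right invariant under `GL₂(𝔬)`. -/
def IsSpherical [ValuativeRel F] (B : GL (Fin 2) F → ℂ) : Prop :=
  ∀ k ∈ maxCompact F, rightRegular F k B = B

end GL2

section Induced

variable {F : Type*} [Field F] [ValuativeRel F] [TopologicalSpace F] [IsNonarchimedeanLocalField F]

/-- The (normalized) principal series `χ₁ × χ₂`: the locally constant functions `f` on `GL₂(F)` with
`f([α u; 0 δ] g) = χ₁(α) χ₂(δ) |α/δ|^{1/2} f(g)`, on which `GL₂(F)` acts by right translation. -/
def principalSeries (χ₁ χ₂ : Fˣ →ₜ* ℂˣ) : Subrepresentation (rightRegular F) where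
  toSubmodule :=
    { carrier := {f | IsLocallyConstant f ∧ ∀ (α δ : Fˣ) (u : F) (g : GL (Fin 2) F),
        f (upperTri α δ u * g) =
          (χ₁ α : ℂ) * (χ₂ δ : ℂ) * (Real.sqrt (normalizedAbs F (α / δ)) : ℂ) * f g}
      add_mem' := by
        rintro f f' ⟨h1, h2⟩ ⟨h1', h2'⟩
        refine ⟨h1.add h1', fun α δ u g => ?_⟩
        simp only [Pi.add_apply, h2, h2', mul_add]
      zero_mem' := ⟨IsLocallyConstant.const 0, by simp⟩
      smul_mem' := by
        rintro z f ⟨h1, h2⟩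
        refine ⟨h1.comp (fun w => z • w), fun α δ u g => ?_⟩
        simp only [Pi.smul_apply, h2, smul_eq_mul]
        ring }
  apply_mem_toSubmodule := by
    rintro g f ⟨h1, h2⟩
    refine ⟨h1.comp_continuous (continuous_mul_const g), fun α δ u h => ?_⟩
    change f (upperTri α δ u * h * g) = _ * f (h * g)
    rw [mul_assoc, h2]

end Induced

section Quadratic

variable {F : Type*} [Field F] [ValuativeRel F] (L : Type*) [CommRing L] [Algebra F L]

/-- `L`, together with the element `δ` in the role of `√d`, is the quadratic algebra attached to
`d`: if `d` is not a square, it is the field `F(√d)`; otherwise it is `F ⊕ F`, with `F` embedded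
diagonally and `δ` corresponding to `(√d, -√d)`. -/
structure IsQuadraticAlgebra {L : Type*} [CommRing L] [Algebra F L] (d : F) (δ : L) : Prop where
  sq_eq : δ ^ 2 = algebraMap F L d
  field : ¬ IsSquare d → IsField L ∧ Algebra.adjoin F {δ} = ⊤
  split : IsSquare d → ∃ (e : L ≃ₐ[F] F × F) (s : F), e δ = (s, -s)

variable (F)

/-- The ring `𝔬_L` of elements of `L` that are integral over `𝔬`: the ring of integers of `L` if `L`
is a field, and `𝔬 ⊕ 𝔬` if `L = F ⊕ F`. -/
abbrev integersOf : Subalgebra 𝒪[F] L := integralClosure 𝒪[F] L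

/-- The ideal `𝔓_L = 𝔭 𝔬_L` of `𝔬_L`. -/
def primeExt : Ideal (integersOf F L) :=
  Ideal.map (algebraMap 𝒪[F] (integersOf F L)) 𝓂[F]

/-- The discriminant of the quadratic extension `L/F`, as an `𝔬`-submodule of `F`: it is generated
by the discriminants `det (Tr(vᵢ vⱼ))` of all pairs `v` of elements of `𝔬_L`. -/
def discriminant : Submodule 𝒪[F] F :=
  Submodule.span 𝒪[F]
    {x | ∃ v : Fin 2 → integersOf F L, x = Algebra.discr F (fun i => (v i : L))}

open Classical in
/-- The Legendre symbol `(L/𝔭)` of the quadratic algebra `L` attached to `d`: `1` if `L = F ⊕ F`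
(that is, `d` is a square), `-1` if `L/F` is an unramified field extension (that is, `𝔭 𝔬_L` is the
maximal ideal of `𝔬_L`), and `0` if `L/F` is a ramified field extension. -/
def legendre (d : F) : ℤ :=
  if IsSquare d then 1 else if (primeExt F L).IsMaximal then -1 else 0

variable {L} [TopologicalSpace L]

/-- The number `c(Ω) = min {m ≥ 0 : Ω = 1 on (1 + 𝔓_L^m) ∩ 𝔬_Lˣ}`. -/
def conductorExp (Ω : Lˣ →ₜ* ℂˣ) : ℕ :=
  sInf {m : ℕ | ∀ u : (integersOf F L)ˣ, (u : integersOf F L) - 1 ∈ primeExt F L ^ m →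
    Ω (Units.map (algebraMap (integersOf F L) L).toMonoidHom u) = 1}

variable {F}

/-- For an `F`-algebra isomorphism `e` of `L` with `F ⊕ F`, the unit of `L` corresponding
to `(x, y)`. -/
def splitUnit (e : L ≃ₐ[F] F × F) (x y : Fˣ) : Lˣ :=
  Units.map e.symm.toRingEquiv.toRingHom.toMonoidHom (MulEquiv.prodUnits.symm (x, y))

end Quadratic

section Model

variable {F : Type*} [Field F] [ValuativeRel F] [TopologicalSpace F] [IsNonarchimedeanLocalField F]
  {L : Type*} [CommRing L] [Algebra F L] [TopologicalSpace L]

/-- The space `𝓑(Ω)` of all locally constant functions `B` on `GL₂(F)` with `B(t g) = Ω(t) B(g)` for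
all `t ∈ T(F)`, on which `GL₂(F)` acts by right translation.  Here `Ω` is viewed as a character of
`T(F)` through the isomorphism `T(F) ≅ Lˣ`, `x + y ξ ↦ x + y √d / 2`, where `δ = √d`. -/
def waldspurgerSpace (a b c : F) (δ : L) (Ω : Lˣ →ₜ* ℂˣ) : Subrepresentation (rightRegular F) where
  toSubmodule :=
    { carrier := {B | IsLocallyConstant B ∧ ∀ t ∈ torus a b c, ∀ (x y : F) (z : Lˣ),
        (t : Matrix (Fin 2) (Fin 2) F) =
          x • (1 : Matrix (Fin 2) (Fin 2) F) + y • matXi a b c →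
        (z : L) = algebraMap F L x + algebraMap F L (y / 2) * δ →
        ∀ g : GL (Fin 2) F, B (t * g) = (Ω z : ℂ) * B g}
      add_mem' := by
        rintro f f' ⟨h1, h2⟩ ⟨h1', h2'⟩
        refine ⟨h1.add h1', fun t ht x y z htx hz g => ?_⟩
        simp only [Pi.add_apply, h2 t ht x y z htx hz, h2' t ht x y z htx hz, mul_add]
      zero_mem' := ⟨IsLocallyConstant.const 0, by simp⟩
      smul_mem' := by
        rintro w f ⟨h1, h2⟩
        refine ⟨h1.comp (fun v => w • v), fun t ht x y z htx hz g => ?_⟩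
        simp only [Pi.smul_apply, h2 t ht x y z htx hz, smul_eq_mul]
        ring }
  apply_mem_toSubmodule := by
    rintro g f ⟨h1, h2⟩
    refine ⟨h1.comp_continuous (continuous_mul_const g), fun t ht x y z htx hz h => ?_⟩
    change f (t * h * g) = _ * f (h * g)
    rw [mul_assoc, h2 t ht x y z htx hz]

/-- `W` is an `(S, Ω)`-Waldspurger model of the principal series `χ₁ × χ₂`: a subrepresentation of
`𝓑(Ω)` that is isomorphic to `χ₁ × χ₂`. -/
structure IsWaldspurgerModel (a b c : F) (δ : L) (Ω : Lˣ →ₜ* ℂˣ) (χ₁ χ₂ : Fˣ →ₜ* ℂˣ)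
    (W : Subrepresentation (rightRegular F)) : Prop where
  le : W ≤ waldspurgerSpace a b c δ Ω
  equiv : Nonempty
    (Representation.Equiv (principalSeries χ₁ χ₂).toRepresentation W.toRepresentation)

end Model

end Waldspurger

end

namespace Waldspurger

/-! ### Right invariance under `GL₂(𝔬)` and primitive bottom rows. -/

section Spherical

variable {F : Type*} [Field F] [ValuativeRel F]

/-! The values β(m) = B₀(diag(ϖ^m, 1)) satisfy a three-term linear recursion, which comes from the
Hecke operator summing right translates over the q + 1 matrices `upperTri ϖ 1 u` (u modulo 𝔭) and
`upperTri 1 ϖ 0`. A spherical vector of χ₁ × χ₂ is an eigenvector with eigenvalue λ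
(`principalSeries_hecke`), and an isomorphism of representations carries this to the Waldspurger
model (`IsWaldspurgerModel.hecke`).

Put θ = (b + √d)/2, so θ² = bθ - ac and N(x + yθ) = x² + bxy + acy². The discriminant hypotheses say
exactly that 𝔬_L = 𝔬 + 𝔬θ (`IsQuadraticAlgebra.isIntegralTheta`), so units, 𝔓_L^m and c(Ω) can all
be read off from coordinates. Each translate in the Hecke sum is rewritten as (torus element) ·
diag(ϖ^k, 1) · (element of `GL₂(𝔬)`). At diag(ϖ^(m+1), 1) with m + 1 ≥ c(Ω), the q upper triangular
translates involve only torus elements 1 + ϖ^(m+1)yθ, on which Ω is trivial. Hence λβ(m+1) = qβ(m+2)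
+ ω(ϖ)β(m) (`hecke_recursion`).

The constant κ is the initial condition. If c(Ω) > 0, then β(c(Ω) - 1) = 0, because a unit on which
Ω is nontrivial fixes the coset of diag(ϖ^(c(Ω)-1), 1) (`IsIntegralTheta.apply_diagOne_eq_zero`); so
κ = 0. If c(Ω) = 0, the relation at the identity is a sum over the points (x : y) of the projective
line over the residue field. Where N(x + yθ) is a unit the translate has value β(1). Where it is
not, x + yθ is divisible by exactly one of the chosen elements w of 𝔬_L of norm ϖ · unit, and the
value is Ω(w)β(0). There are 0, 1 or 2 such w in the unramified, ramified and split cases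
(`hecke_recursion_zero`). Multiplying the generating series by the denominator then leaves only the
two initial coefficients (`powerSeries_eq_of_recursion`). -/

theorem algebraMap_integer (x : 𝒪[F]) : algebraMap 𝒪[F] F x = x := rfl

theorem IsSpherical.apply_eq {B : GL (Fin 2) F → ℂ} (hB : IsSpherical B) {g h : GL (Fin 2) F}
    (k : Matrix (Fin 2) (Fin 2) 𝒪[F]) (hk : IsUnit k.det)
    (e : (h : Matrix (Fin 2) (Fin 2) F) = g * k.map (algebraMap 𝒪[F] F)) : B h = B g := by
  let k' : GL (Fin 2) 𝒪[F] := Matrix.nonsingInvUnit k hk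
  have h1 := congrFun (hB (Matrix.GeneralLinearGroup.map (n := Fin 2) (algebraMap 𝒪[F] F) k')
    ⟨k', rfl⟩) g
  have h2 : h = g * Matrix.GeneralLinearGroup.map (n := Fin 2) (algebraMap 𝒪[F] F) k' := by
    apply Units.ext
    rw [e]
    rfl
  rw [h2]
  exact h1

theorem exists_primitive_row (g : GL (Fin 2) F) : ∃ (m : Fˣ) (r s : 𝒪[F]),
    (IsUnit r ∨ IsUnit s) ∧ (g : Matrix (Fin 2) (Fin 2) F) 1 0 = m * r ∧
      (g : Matrix (Fin 2) (Fin 2) F) 1 1 = m * s := by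
  have hdet : (g : Matrix (Fin 2) (Fin 2) F).det ≠ 0 :=
    ((Matrix.isUnit_iff_isUnit_det _).mp g.isUnit).ne_zero
  rw [Matrix.det_fin_two] at hdet
  set x := (g : Matrix (Fin 2) (Fin 2) F) 1 0
  set y := (g : Matrix (Fin 2) (Fin 2) F) 1 1
  rcases le_total (valuation F x) (valuation F y) with h | h
  · have hy : y ≠ 0 := by
      rintro hy
      rw [hy, map_zero, le_zero_iff, map_eq_zero] at h
      simp [h, hy] at hdet
    refine ⟨Units.mk0 y hy, ⟨x / y, ?_⟩, 1, Or.inr isUnit_one, ?_, ?_⟩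
    · change valuation F (x / y) ≤ 1
      rw [map_div₀]
      exact div_le_one_of_le₀ h zero_le
    · simp only [Units.val_mk0]; field_simp
    · simp
  · have hx : x ≠ 0 := by
      rintro hx
      rw [hx, map_zero, le_zero_iff, map_eq_zero] at h
      simp [h, hx] at hdet
    refine ⟨Units.mk0 x hx, 1, ⟨y / x, ?_⟩, Or.inl isUnit_one, ?_, ?_⟩
    · change valuation F (y / x) ≤ 1
      rw [map_div₀]
      exact div_le_one_of_le₀ h zero_le
    · simp
    · simp only [Units.val_mk0]; field_simp

end Spherical

/-! ### The normalized absolute value. -/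

section LocalField

variable {F : Type*} [Field F] [ValuativeRel F] [TopologicalSpace F] [IsNonarchimedeanLocalField F]

theorem normalizedAbs_pos (x : Fˣ) : 0 < normalizedAbs F x := by
  have : Nonempty 𝓀[F] := ⟨0⟩
  exact zpow_pos (Nat.cast_pos.mpr Nat.card_pos) _

theorem normalizedAbs_mul (x y : Fˣ) :
    normalizedAbs F (x * y) = normalizedAbs F x * normalizedAbs F y := by
  have : Nonempty 𝓀[F] := ⟨0⟩
  have hq : (residueCard F : ℝ) ≠ 0 := Nat.cast_ne_zero.mpr Nat.card_pos.ne'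
  unfold normalizedAbs
  rw [← zpow_add₀ hq, Units.val_mul, map_mul, map_mul, WithZero.log_mul (by simp) (by simp)]

theorem normalizedAbs_uniformizer {ϖ : Fˣ} (hϖ : IsUniformizer 𝒪[F] ϖ) :
    normalizedAbs F ϖ = (residueCard F : ℝ)⁻¹ := by
  obtain ⟨π, hπ, hπϖ⟩ := hϖ
  have hint : (valuation F).Integers 𝒪[F] := Valuation.integer.integers _
  set e := IsNonarchimedeanLocalField.valueGroupWithZeroIsoInt F with he
  have key : WithZero.log (e (valuation F (ϖ : F))) = -1 := by
    have h0 : e (valuation F (ϖ : F)) ≠ 0 := by simp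
    apply le_antisymm
    · have h1 : valuation F (ϖ : F) < 1 := by
        rw [← hπϖ]; exact hint.valuation_irreducible_lt_one hπ
      have h2 : e (valuation F (ϖ : F)) < 1 := by
        rw [← map_one e]; exact e.strictMono h1
      have h3 := (WithZero.log_lt_log h0 one_ne_zero).mpr h2
      rw [WithZero.log_one] at h3
      omega
    -- Some x has valuation exactly `exp (-1)`; it lies in the maximal ideal, so π divides it and
    -- cannot have smaller valuation.
    · obtain ⟨x, hx⟩ := ValuativeRel.valuation_surjective (e.symm (WithZero.exp (-1)))
      have hx' : e (valuation F x) = WithZero.exp (-1) := by rw [hx]; simp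
      have h4 : valuation F x < 1 := by
        rw [← e.strictMono.lt_iff_lt, hx', map_one, ← WithZero.exp_zero]
        exact WithZero.exp_lt_exp.mpr (by norm_num)
      have h5 : ¬ IsUnit (⟨x, h4.le⟩ : 𝒪[F]) := by
        rw [hint.isUnit_iff_valuation_eq_one]
        exact h4.ne
      have h6 : π ∣ (⟨x, h4.le⟩ : 𝒪[F]) := by
        rw [← Ideal.mem_span_singleton, ← hπ.maximalIdeal_eq]
        exact h5
      have h7 := hint.le_of_dvd h6
      rw [hπϖ] at h7
      have h8 : e (valuation F x) ≤ e (valuation F (ϖ : F)) := e.strictMono.monotone h7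
      rw [hx', ← WithZero.log_le_log (by simp) h0, WithZero.log_exp] at h8
      exact h8
  unfold normalizedAbs
  rw [key, zpow_neg_one]

theorem residueCard_pos : 0 < residueCard F := by
  have : Nonempty 𝓀[F] := ⟨0⟩
  exact Nat.card_pos

end LocalField

/-! ### The Hecke eigenvalue of a spherical vector. -/

section Hecke

theorem coe_upperTri {F : Type*} [Field F] (α δ : Fˣ) (u : F) :
    (upperTri α δ u : Matrix (Fin 2) (Fin 2) F) = !![(α : F), u; 0, (δ : F)] := rfl

variable {F : Type*} [Field F] [ValuativeRel F] [TopologicalSpace F] [IsNonarchimedeanLocalField F]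

/-- An explicit Iwasawa decomposition: the determinant and the bottom row m(r, s), with (r, s)
primitive, determine the diagonal of the triangular factor up to units. -/
theorem principalSeries_spherical_apply {χ₁ χ₂ : Fˣ →ₜ* ℂˣ} {f : GL (Fin 2) F → ℂ}
    (hf : f ∈ principalSeries χ₁ χ₂) (hs : IsSpherical f) (g : GL (Fin 2) F) (m D : Fˣ)
    (hD : (g : Matrix (Fin 2) (Fin 2) F).det = D) (r s : 𝒪[F]) (hrs : IsUnit r ∨ IsUnit s)
    (h0 : (g : Matrix (Fin 2) (Fin 2) F) 1 0 = m * r)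
    (h1 : (g : Matrix (Fin 2) (Fin 2) F) 1 1 = m * s) :
    f g = (χ₁ (D / m) : ℂ) * (χ₂ m : ℂ) * (Real.sqrt (normalizedAbs F (D / m / m)) : ℂ) * f 1 := by
  have hm : (m : F) ≠ 0 := m.ne_zero
  rw [Matrix.det_fin_two, h0, h1] at hD
  suffices ∃ (u : F) (k : Matrix (Fin 2) (Fin 2) 𝒪[F]), IsUnit k.det ∧
      (g : Matrix (Fin 2) (Fin 2) F) =
        (upperTri (D / m) m u : Matrix (Fin 2) (Fin 2) F) * k.map (algebraMap 𝒪[F] F) by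
    obtain ⟨u, k, hk, e⟩ := this
    rw [hs.apply_eq k hk e, ← mul_one (upperTri (D / m) m u), hf.2]
  rcases hrs with ⟨r', rfl⟩ | ⟨s', rfl⟩
  · have hr : (((r' : 𝒪[F]) : F)) * ((((r'⁻¹ : 𝒪[F]ˣ)) : 𝒪[F]) : F) = 1 := by
      rw [← Subring.coe_mul, Units.mul_inv]; rfl
    -- The integral factor is the row (r, s) completed to a matrix of determinant 1; u is then
    -- forced by the first row of g.
    refine ⟨(g : Matrix (Fin 2) (Fin 2) F) 0 0 * (((r'⁻¹ : 𝒪[F]ˣ) : 𝒪[F]) : F),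
      !![0, -((r'⁻¹ : 𝒪[F]ˣ) : 𝒪[F]); r', s], by simp [Matrix.det_fin_two_of], ?_⟩
    rw [Matrix.eta_fin_two (g : Matrix (Fin 2) (Fin 2) F), h0, h1, coe_upperTri]
    ext i j
    fin_cases i <;> fin_cases j
    · simp [Matrix.mul_apply, algebraMap_integer]
      linear_combination (-(g : Matrix (Fin 2) (Fin 2) F) 0 0) * hr
    · simp [Matrix.mul_apply, ← hD, algebraMap_integer]
      field_simp
      linear_combination (-(g : Matrix (Fin 2) (Fin 2) F) 0 1) * hr
    · simp [Matrix.mul_apply, algebraMap_integer]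
    · simp [Matrix.mul_apply, algebraMap_integer]
  · have hr : (((s' : 𝒪[F]) : F)) * ((((s'⁻¹ : 𝒪[F]ˣ)) : 𝒪[F]) : F) = 1 := by
      rw [← Subring.coe_mul, Units.mul_inv]; rfl
    refine ⟨(g : Matrix (Fin 2) (Fin 2) F) 0 1 * (((s'⁻¹ : 𝒪[F]ˣ) : 𝒪[F]) : F),
      !![((s'⁻¹ : 𝒪[F]ˣ) : 𝒪[F]), 0; r, s'], by simp [Matrix.det_fin_two_of], ?_⟩
    rw [Matrix.eta_fin_two (g : Matrix (Fin 2) (Fin 2) F), h0, h1, coe_upperTri]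
    ext i j
    fin_cases i <;> fin_cases j
    · simp [Matrix.mul_apply, ← hD, algebraMap_integer]
      field_simp
      linear_combination (-(g : Matrix (Fin 2) (Fin 2) F) 0 0) * hr
    · simp [Matrix.mul_apply, algebraMap_integer]
      linear_combination (-(g : Matrix (Fin 2) (Fin 2) F) 0 1) * hr
    · simp [Matrix.mul_apply, algebraMap_integer]
    · simp [Matrix.mul_apply, algebraMap_integer]

theorem isUnit_or_dvd {R : Type*} [CommRing R] [IsDomain R] [IsDiscreteValuationRing R] {π : R}
    (hπ : Irreducible π) (x : R) : IsUnit x ∨ π ∣ x := by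
  by_cases h : IsUnit x
  · exact Or.inl h
  · right
    rw [← Ideal.mem_span_singleton, ← hπ.maximalIdeal_eq]
    exact h

/-- Of the q + 1 translates, q keep the bottom row primitive up to the same scalar m (`good`, factor
χ₁(ϖ)q^(-1/2)), and exactly one makes it divisible by ϖ once more (`bad`, factor χ₂(ϖ)q^(1/2)). The
total is q^(1/2)(χ₁(ϖ) + χ₂(ϖ)). -/
theorem principalSeries_hecke {χ₁ χ₂ : Fˣ →ₜ* ℂˣ} {f : GL (Fin 2) F → ℂ}
    (hf : f ∈ principalSeries χ₁ χ₂) (hs : IsSpherical f) {ϖ : Fˣ}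
    (hϖ : IsUniformizer 𝒪[F] ϖ) [Fintype 𝓀[F]] (σ : 𝓀[F] → 𝒪[F])
    (hσ : ∀ x, IsLocalRing.residue 𝒪[F] (σ x) = x) (g : GL (Fin 2) F) :
    ∑ x, f (g * upperTri ϖ 1 (σ x)) + f (g * upperTri 1 ϖ 0) =
      (Real.sqrt (residueCard F) : ℂ) * ((χ₁ ϖ : ℂ) + (χ₂ ϖ : ℂ)) * f g := by
  classical
  have hQ := residueCard_pos (F := F)
  have hcard : (Fintype.card 𝓀[F] : ℂ) = (Real.sqrt (residueCard F) : ℂ) ^ 2 := by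
    rw [← Complex.ofReal_pow, Real.sq_sqrt (Nat.cast_nonneg _), residueCard,
      Nat.card_eq_fintype_card]
    simp
  have hq0 : (Real.sqrt (residueCard F) : ℂ) ≠ 0 := by
    rw [Complex.ofReal_ne_zero]
    exact (Real.sqrt_pos.mpr (Nat.cast_pos.mpr hQ)).ne'
  have hnorm := normalizedAbs_uniformizer hϖ
  obtain ⟨π, hπ, hπϖ⟩ := hϖ
  have hπϖ' : (π : F) = ϖ := hπϖ
  obtain ⟨m, r, s, hrs, h0, h1⟩ := exists_primitive_row g
  have hm : (m : F) ≠ 0 := m.ne_zero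
  let D : Fˣ := Matrix.GeneralLinearGroup.det g
  have hD : (g : Matrix (Fin 2) (Fin 2) F).det = D := rfl
  set V := f g with hV
  rw [principalSeries_spherical_apply hf hs g m D hD r s hrs h0 h1] at hV
  have good : ∀ (γ : GL (Fin 2) F), (γ : Matrix (Fin 2) (Fin 2) F).det = ϖ → ∀ r' s' : 𝒪[F],
      IsUnit r' ∨ IsUnit s' → ((g * γ : GL (Fin 2) F) : Matrix (Fin 2) (Fin 2) F) 1 0 = m * r' →
      ((g * γ : GL (Fin 2) F) : Matrix (Fin 2) (Fin 2) F) 1 1 = m * s' →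
      f (g * γ) = (χ₁ ϖ : ℂ) * (Real.sqrt (residueCard F) : ℂ)⁻¹ * V := by
    intro γ hγ r' s' hrs' h0' h1'
    rw [principalSeries_spherical_apply hf hs (g * γ) m (D * ϖ) (by simp [hD, hγ]) r' s' hrs' h0'
      h1', hV, mul_div_right_comm D, mul_div_right_comm (D / m), normalizedAbs_mul,
      hnorm, Real.sqrt_mul (normalizedAbs_pos _).le, Real.sqrt_inv,
      map_mul]
    push_cast
    ring
  have bad : ∀ (γ : GL (Fin 2) F), (γ : Matrix (Fin 2) (Fin 2) F).det = ϖ → ∀ r' s' : 𝒪[F],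
      IsUnit r' ∨ IsUnit s' →
      ((g * γ : GL (Fin 2) F) : Matrix (Fin 2) (Fin 2) F) 1 0 = m * (π * r') →
      ((g * γ : GL (Fin 2) F) : Matrix (Fin 2) (Fin 2) F) 1 1 = m * (π * s') →
      f (g * γ) = (χ₂ ϖ : ℂ) * (Real.sqrt (residueCard F) : ℂ) * V := by
    intro γ hγ r' s' hrs' h0' h1'
    have hinv : normalizedAbs F ϖ⁻¹ = residueCard F := by
      have := normalizedAbs_mul ϖ ϖ⁻¹
      have h1 := normalizedAbs_mul (F := F) 1 1
      have h2 := normalizedAbs_pos (F := F) 1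
      rw [mul_one, left_eq_mul₀ h2.ne'] at h1
      rw [mul_inv_cancel, hnorm, h1] at this
      have hQ' : (residueCard F : ℝ) ≠ 0 := Nat.cast_ne_zero.mpr hQ.ne'
      field_simp at this
      exact this.symm
    rw [principalSeries_spherical_apply hf hs (g * γ) (m * ϖ) (D * ϖ) (by simp [hD, hγ]) r' s' hrs'
      (by rw [h0', hπϖ']; push_cast; ring) (by rw [h1', hπϖ']; push_cast; ring), hV,
      mul_div_mul_right_eq_div,
      div_mul_eq_div_div (D / m), div_eq_mul_inv _ ϖ,
      normalizedAbs_mul, hinv, Real.sqrt_mul (normalizedAbs_pos _).le, map_mul]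
    push_cast
    ring
  have hinfdet : (upperTri 1 ϖ 0 : Matrix (Fin 2) (Fin 2) F).det = ϖ := by
    simp [coe_upperTri, Matrix.det_fin_two_of]
  have hudet : ∀ u, (upperTri ϖ 1 u : Matrix (Fin 2) (Fin 2) F).det = ϖ := by
    simp [coe_upperTri, Matrix.det_fin_two_of]
  have hu0 : ∀ u, ((g * upperTri ϖ 1 u : GL (Fin 2) F) : Matrix (Fin 2) (Fin 2) F) 1 0 =
      m * (π * r) := by
    intro u
    simp [coe_upperTri, Matrix.mul_apply, h0, hπϖ']
    ring
  have hu1 : ∀ u : 𝒪[F], ((g * upperTri ϖ 1 (u : F) : GL (Fin 2) F) : Matrix (Fin 2) (Fin 2) F) 1 1 =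
      m * ((r * u + s : 𝒪[F]) : F) := by
    intro u
    simp [coe_upperTri, Matrix.mul_apply, h0, h1]
    ring
  have hi0 : ((g * upperTri 1 ϖ 0 : GL (Fin 2) F) : Matrix (Fin 2) (Fin 2) F) 1 0 = m * r := by
    simp [coe_upperTri, Matrix.mul_apply, h0]
  have hi1 : ((g * upperTri 1 ϖ 0 : GL (Fin 2) F) : Matrix (Fin 2) (Fin 2) F) 1 1 =
      m * (π * s) := by
    simp [coe_upperTri, Matrix.mul_apply, h1, hπϖ']
    ring
  by_cases hr : IsUnit r
  · have hr' : IsLocalRing.residue 𝒪[F] r ≠ 0 := by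
      rwa [IsLocalRing.residue_ne_zero_iff_isUnit]
    -- With r a unit, the bad translate is the one whose u solves ru + s ≡ 0 modulo 𝔭; with r a
    -- nonunit it is `upperTri 1 ϖ 0`.
    set x₀ := -IsLocalRing.residue 𝒪[F] s / IsLocalRing.residue 𝒪[F] r with hx₀
    have hterm : ∀ x, f (g * upperTri ϖ 1 (σ x)) =
        (χ₁ ϖ : ℂ) * (Real.sqrt (residueCard F) : ℂ)⁻¹ * V + if x = x₀ then
          (χ₂ ϖ : ℂ) * (Real.sqrt (residueCard F) : ℂ) * V -
          (χ₁ ϖ : ℂ) * (Real.sqrt (residueCard F) : ℂ)⁻¹ * V else 0 := by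
      intro x
      have hres : IsLocalRing.residue 𝒪[F] (r * σ x + s) = 0 ↔ x = x₀ := by
        rw [map_add, map_mul, hσ, hx₀, eq_div_iff hr', eq_neg_iff_add_eq_zero, mul_comm]
      rw [IsLocalRing.residue_eq_zero_iff] at hres
      split_ifs with hx
      · have := hres.mpr hx
        rw [hπ.maximalIdeal_eq, Ideal.mem_span_singleton] at this
        obtain ⟨t, ht⟩ := this
        rw [bad _ (hudet _) r t (Or.inl hr) (hu0 _) (by rw [hu1, ht]; rfl)]
        ring
      · rw [good _ (hudet _) (π * r) (r * σ x + s) (Or.inr ?_) (hu0 _) (hu1 _), add_zero]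
        by_contra hcon
        exact hx (hres.mp hcon)
    rw [Finset.sum_congr rfl fun x _ => hterm x, Finset.sum_add_distrib, Finset.sum_ite_eq',
      good _ hinfdet r (π * s) (Or.inl hr) hi0 hi1]
    simp only [Finset.sum_const, Finset.card_univ, nsmul_eq_mul, Finset.mem_univ, if_true, hcard]
    field_simp
    ring
  · have hsu : IsUnit s := hrs.resolve_left hr
    obtain ⟨t, rfl⟩ := (isUnit_or_dvd hπ r).resolve_left hr
    have hterm : ∀ x, f (g * upperTri ϖ 1 (σ x)) =
        (χ₁ ϖ : ℂ) * (Real.sqrt (residueCard F) : ℂ)⁻¹ * V := by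
      intro x
      refine good _ (hudet _) (π * (π * t)) _ (Or.inr ?_) (hu0 _) (hu1 _)
      by_contra hcon
      apply hπ.not_isUnit
      have h2 := (isUnit_or_dvd hπ _).resolve_left hcon
      rw [mul_assoc, dvd_add_right (dvd_mul_right _ _)] at h2
      exact isUnit_of_dvd_unit h2 hsu
    rw [Finset.sum_congr rfl fun x _ => hterm x, bad _ hinfdet t s (Or.inr hsu) hi0 hi1]
    simp only [Finset.sum_const, Finset.card_univ, nsmul_eq_mul, hcard]
    field_simp

/-- The preimage of B in χ₁ × χ₂ is again spherical, and the Hecke operator is a sum of group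
actions, so it commutes with the isomorphism. -/
theorem IsWaldspurgerModel.hecke {L : Type*} [CommRing L] [Algebra F L] [TopologicalSpace L]
    {a b c : F} {δ : L} {Ω : Lˣ →ₜ* ℂˣ} {χ₁ χ₂ : Fˣ →ₜ* ℂˣ} {W : Subrepresentation (rightRegular F)}
    (hW : IsWaldspurgerModel a b c δ Ω χ₁ χ₂ W) {B : GL (Fin 2) F → ℂ} (hB : B ∈ W)
    (hs : IsSpherical B) {ϖ : Fˣ} (hϖ : IsUniformizer 𝒪[F] ϖ) [Fintype 𝓀[F]] (σ : 𝓀[F] → 𝒪[F])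
    (hσ : ∀ x, IsLocalRing.residue 𝒪[F] (σ x) = x) (g : GL (Fin 2) F) :
    ∑ x, B (g * upperTri ϖ 1 (σ x)) + B (g * upperTri 1 ϖ 0) =
      (Real.sqrt (residueCard F) : ℂ) * ((χ₁ ϖ : ℂ) + (χ₂ ϖ : ℂ)) * B g := by
  obtain ⟨φ⟩ := hW.equiv
  obtain ⟨f, hf⟩ := φ.toLinearEquiv.surjective ⟨B, hB⟩
  have hφ : ∀ (g : GL (Fin 2) F) (v : (principalSeries χ₁ χ₂).toSubmodule),
      φ.toLinearEquiv ((principalSeries χ₁ χ₂).toRepresentation g v) =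
        W.toRepresentation g (φ.toLinearEquiv v) :=
    fun g v => φ.toIntertwiningMap.isIntertwining _ _ g v
  have hfs : IsSpherical (f : GL (Fin 2) F → ℂ) := by
    intro k hk
    have : (principalSeries χ₁ χ₂).toRepresentation k f = f := by
      apply φ.toLinearEquiv.injective
      rw [hφ, hf]
      exact Subtype.ext (hs k hk)
    exact congrArg Subtype.val this
  have key : ∑ x, (principalSeries χ₁ χ₂).toRepresentation (upperTri ϖ 1 (σ x)) f +
      (principalSeries χ₁ χ₂).toRepresentation (upperTri 1 ϖ 0) f =
      ((Real.sqrt (residueCard F) : ℂ) * ((χ₁ ϖ : ℂ) + (χ₂ ϖ : ℂ))) • f := by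
    apply Subtype.ext
    funext h
    have := principalSeries_hecke f.2 hfs hϖ σ hσ h
    rw [Submodule.coe_add, Submodule.coe_sum, Submodule.coe_smul, Pi.add_apply, Finset.sum_apply]
    exact this
  have key2 := congrArg φ.toLinearEquiv key
  rw [map_add, map_sum, map_smul] at key2
  simp only [hφ, hf] at key2
  have key3 := congrFun (congrArg Subtype.val key2) g
  rw [Submodule.coe_add, Submodule.coe_sum, Submodule.coe_smul, Pi.add_apply,
    Finset.sum_apply] at key3
  exact key3

end Hecke

/-! ### The norm form and divisibility by elements of uniformizing norm. -/

section NormForm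

variable {R : Type*} [CommRing R]

/-- The norm form `x² + b x y + a c y²` of the order `R + R θ`, where `θ² = b θ - a c`. -/
def normForm (a b c x y : R) : R := x ^ 2 + b * x * y + a * c * y ^ 2

/-- The product of `x + y θ` with the conjugate of `p + r θ` is divisible by `π`. -/
def ConjDvd (π a b c p r x y : R) : Prop :=
  π ∣ x * (p + r * b) + y * r * (a * c) ∧ π ∣ y * p - x * r

/-- When p + rθ has norm π · unit, `ConjDvd` expresses that p + rθ divides x + yθ in R + Rθ. Taking
norms of the product with the conjugate gives π · unit · N(x + yθ) = π² · N(s + tθ). -/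
theorem ConjDvd.dvd_normForm [IsDomain R] {π a b c p r x y : R} (hπ : Irreducible π)
    (h : ConjDvd π a b c p r x y) (e : Rˣ) (he : normForm a b c p r = π * e) :
    π ∣ normForm a b c x y := by
  obtain ⟨⟨s, hs⟩, ⟨t, ht⟩⟩ := h
  refine (e.isUnit.dvd_mul_right).mp ⟨normForm a b c s t, ?_⟩
  apply mul_left_cancel₀ hπ.ne_zero
  calc π * (normForm a b c x y * e) = normForm a b c x y * (π * e) := by ring
    _ = normForm a b c (x * (p + r * b) + y * r * (a * c)) (y * p - x * r) := by
      rw [← he]; simp only [normForm]; ring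
    _ = normForm a b c (π * s) (π * t) := by rw [hs, ht]
    _ = _ := by simp only [normForm]; ring

variable [IsDomain R] [IsDiscreteValuationRing R]

/-- Among the points (1 : u/c) and (0 : 1) of the projective line, only the reduction of (p : r)
satisfies `ConjDvd`. The second congruence says that the points are equal; the first then follows
from π ∣ N(p + rθ). -/
theorem sum_conjDvd [Fintype (IsLocalRing.ResidueField R)] {π : R} (hπ : Irreducible π)
    (σ : IsLocalRing.ResidueField R → R) (hσ : ∀ x, IsLocalRing.residue R (σ x) = x)
    (a b : R) (c : Rˣ) (p r : R) (e : Rˣ) (he : normForm a b c p r = π * e) (D : ℂ)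
    [∀ x y, Decidable (ConjDvd π a b c p r x y)] :
    (∑ x, if ConjDvd π a b c p r 1 (σ x * ((c⁻¹ : Rˣ) : R)) then D else 0) +
      (if ConjDvd π a b c p r 0 1 then D else 0) = D := by
  classical
  have hcc : (c : R) * ((c⁻¹ : Rˣ) : R) = 1 := c.mul_inv
  have hres : ∀ x : R, π ∣ x ↔ IsLocalRing.residue R x = 0 := by
    intro x
    rw [IsLocalRing.residue_eq_zero_iff, hπ.maximalIdeal_eq, Ideal.mem_span_singleton]
  have hπe : π ∣ normForm a b c p r := he ▸ dvd_mul_right _ _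
  unfold normForm at he hπe
  rcases isUnit_or_dvd hπ p with hp | hp
  · have hp' : IsLocalRing.residue R p ≠ 0 := by
      rwa [IsLocalRing.residue_ne_zero_iff_isUnit]
    have hinf : ¬ ConjDvd π a b c p r 0 1 := by
      rintro ⟨-, h⟩
      refine hπ.not_isUnit (isUnit_of_dvd_unit ?_ hp)
      simpa using h
    have hx : ∀ x, ConjDvd π a b c p r 1 (σ x * ((c⁻¹ : Rˣ) : R)) ↔
        x = IsLocalRing.residue R (r * c) / IsLocalRing.residue R p := by
      intro x
      rw [eq_div_iff hp', ← sub_eq_zero]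
      have hx1 : x * IsLocalRing.residue R p - IsLocalRing.residue R (r * c) =
          IsLocalRing.residue R (σ x * p - r * c) := by
        rw [map_sub, map_mul (IsLocalRing.residue R) (σ x), hσ]
      rw [hx1, ← hres]
      constructor
      · rintro ⟨-, h⟩
        have h2 := h.mul_left (c : R)
        have h3 : (c : R) * (σ x * ((c⁻¹ : Rˣ) : R) * p - 1 * r) = σ x * p - r * c := by
          linear_combination σ x * p * hcc
        rwa [h3] at h2
      · rintro ⟨t, ht⟩
        have h2 : σ x * ((c⁻¹ : Rˣ) : R) * p - 1 * r = π * (t * ((c⁻¹ : Rˣ) : R)) := by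
          linear_combination ((c⁻¹ : Rˣ) : R) * ht + r * hcc
        refine ⟨?_, ⟨_, h2⟩⟩
        obtain ⟨s, hs⟩ := hπe
        refine (hp.dvd_mul_left (u := p)).mp ⟨s + (t * ((c⁻¹ : Rˣ) : R)) * r * (a * c), ?_⟩
        linear_combination hs + r * (a * c) * h2
    simp only [hx, hinf, if_false, add_zero, Finset.sum_ite_eq', Finset.mem_univ, if_true]
  -- If p and r were both divisible by π, the norm would be divisible by π², against N(p + rθ) = π ·
  -- unit.
  · have hr : IsUnit r := by
      refine (isUnit_or_dvd hπ r).resolve_right fun hr => ?_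
      obtain ⟨s, rfl⟩ := hp
      obtain ⟨t, rfl⟩ := hr
      apply hπ.not_isUnit
      have h2 : (e : R) = π * (s ^ 2 + b * s * t + a * c * t ^ 2) := by
        apply mul_left_cancel₀ hπ.ne_zero
        linear_combination -he
      exact isUnit_of_dvd_unit ⟨_, h2⟩ e.isUnit
    have hinf : ConjDvd π a b c p r 0 1 := by
      refine ⟨?_, by simpa using hp⟩
      rw [zero_mul, zero_add, one_mul]
      refine (hr.dvd_mul_left (u := r)).mp ?_
      obtain ⟨s, rfl⟩ := hp
      obtain ⟨t, ht⟩ := hπe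
      refine ⟨t - π * s ^ 2 - b * s * r, ?_⟩
      linear_combination ht
    have hx : ∀ x, ¬ ConjDvd π a b c p r 1 (σ x * ((c⁻¹ : Rˣ) : R)) := by
      rintro x ⟨-, h⟩
      rw [one_mul, dvd_sub_right (hp.mul_left _)] at h
      exact hπ.not_isUnit (isUnit_of_dvd_unit h hr)
    simp only [hx, hinf, if_false, if_true, Finset.sum_const_zero, zero_add]

theorem isUnit_normForm_of_dvd {π : R} (hπ : Irreducible π) (a b c : R) {y : R} (h : π ∣ y) :
    IsUnit (normForm a b c 1 y) := by
  refine (isUnit_or_dvd hπ _).resolve_right fun h1 => hπ.not_isUnit (isUnit_of_dvd_one ?_)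
  have h2 : normForm a b c 1 y = 1 + y * (b + a * c * y) := by rw [normForm]; ring
  rwa [h2, dvd_add_left (h.mul_right _)] at h1

end NormForm

/-! ### Coordinates x + yθ on the torus. -/

section Torus

variable {F : Type*} [Field F] {L : Type*} [CommRing L] [Algebra F L]

/-- The element `x + y θ` of `L`, where `θ = (b + δ) / 2`. -/
def thetaComb (b : F) (δ : L) (x y : F) : L :=
  algebraMap F L x + algebraMap F L y * (algebraMap F L (b / 2) + algebraMap F L (1 / 2) * δ)

theorem thetaComb_mul [CharZero F] {a b c : F} {δ : L}
    (hδ : δ ^ 2 = algebraMap F L (b ^ 2 - 4 * a * c)) (x y p r : F) :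
    thetaComb b δ x y * thetaComb b δ p r =
      thetaComb b δ (x * p - y * r * (a * c)) (x * r + y * p + y * r * b) := by
  have h1 : algebraMap F L (1 / 2) * 2 = 1 := by
    rw [← map_ofNat (algebraMap F L) 2, ← map_mul]; simp
  have hb : algebraMap F L (b / 2) = algebraMap F L b * algebraMap F L (1 / 2) := by
    rw [← map_mul]; ring_nf
  unfold thetaComb
  simp only [map_add, map_sub, map_mul, map_pow, map_ofNat, hb] at hδ ⊢
  generalize algebraMap F L (1 / 2) = h at *
  generalize algebraMap F L b = b' at *
  linear_combination algebraMap F L y * algebraMap F L r * h ^ 2 * hδ +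
    algebraMap F L y * algebraMap F L r * (b' * h * δ + b' ^ 2 * h - algebraMap F L a * algebraMap F L c * (2 * h + 1)) * h1

theorem thetaComb_mul_conj [CharZero F] {a b c : F} {δ : L}
    (hδ : δ ^ 2 = algebraMap F L (b ^ 2 - 4 * a * c)) (x y : F) :
    thetaComb b δ x y * thetaComb b δ (x + y * b) (-y) = algebraMap F L (normForm a b c x y) := by
  rw [thetaComb_mul hδ]
  unfold thetaComb normForm
  rw [show x * -y + y * (x + y * b) + y * -y * b = 0 by ring, map_zero, zero_mul, add_zero]
  congr 1
  ring

theorem exists_unit_eq_thetaComb [CharZero F] {a b c : F} {δ : L}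
    (hδ : δ ^ 2 = algebraMap F L (b ^ 2 - 4 * a * c)) {x y : F} (h : normForm a b c x y ≠ 0) :
    ∃ z : Lˣ, (z : L) = thetaComb b δ x y := by
  have h1 : IsUnit (thetaComb b δ x y * thetaComb b δ (x + y * b) (-y)) := by
    rw [thetaComb_mul_conj hδ]
    exact (isUnit_iff_ne_zero.mpr h).map (algebraMap F L)
  obtain ⟨z, hz⟩ := isUnit_of_mul_isUnit_left h1
  exact ⟨z, hz⟩

theorem thetaComb_zero (b : F) (δ : L) (x : F) : thetaComb b δ x 0 = algebraMap F L x := by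
  simp [thetaComb]

theorem coe_diagOne (α : Fˣ) : (diagOne α : Matrix (Fin 2) (Fin 2) F) = !![(α : F), 0; 0, 1] := rfl

theorem normForm_coe [ValuativeRel F] (a b c x y : 𝒪[F]) :
    normForm (a : F) b c x y = (normForm a b c x y : 𝒪[F]) := by
  simp [normForm]

theorem exists_unit_eq_thetaComb_coe [CharZero F] [ValuativeRel F] {a b c : 𝒪[F]} {δ : L}
    (hδ : δ ^ 2 = algebraMap F L ((b : F) ^ 2 - 4 * a * c)) {x y : 𝒪[F]}
    (h : normForm a b c x y ≠ 0) : ∃ z : Lˣ, (z : L) = thetaComb (b : F) δ x y := by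
  apply exists_unit_eq_thetaComb hδ
  rw [normForm_coe]
  simpa using h

theorem coe_ne_zero_of_isUnit [ValuativeRel F] {x : 𝒪[F]} (h : IsUnit x) : (x : F) ≠ 0 := by
  simpa using h.ne_zero

variable [CharZero F] [ValuativeRel F] [TopologicalSpace F] [IsNonarchimedeanLocalField F]
  [TopologicalSpace L]

/-- The element p + rθ of L corresponds to p + r(ξ + b/2), which is the displayed matrix. An
identity t g = h k with k integral of unit determinant therefore compares B(h) with B(g). -/
theorem spherical_torus_apply {a b c : F} {δ : L} (hc : c ≠ 0) {Ω : Lˣ →ₜ* ℂˣ}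
    {B : GL (Fin 2) F → ℂ} (hB : B ∈ waldspurgerSpace a b c δ Ω) (hs : IsSpherical B)
    {z : Lˣ} {p r : F} (hz : (z : L) = thetaComb b δ p r) (hN : normForm a b c p r ≠ 0)
    {g h : GL (Fin 2) F} (k : Matrix (Fin 2) (Fin 2) 𝒪[F]) (hk : IsUnit k.det)
    (e : !![p + r * b, r * c; -(r * a), p] * (g : Matrix (Fin 2) (Fin 2) F) =
      h * k.map (algebraMap 𝒪[F] F)) : B h = Ω z * B g := by
  let t : GL (Fin 2) F := Matrix.GeneralLinearGroup.mkOfDetNeZero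
    !![p + r * b, r * c; -(r * a), p] (by
      convert hN using 1
      rw [Matrix.det_fin_two_of, normForm]; ring)
  have ht : (t : Matrix (Fin 2) (Fin 2) F) =
      (p + r * b / 2) • (1 : Matrix (Fin 2) (Fin 2) F) + r • matXi a b c := by
    change !![p + r * b, r * c; -(r * a), p] = _
    ext i j
    fin_cases i <;> fin_cases j <;> simp [matXi] <;> ring
  rw [← hB.2 t ((mem_torus_iff hc t).mpr ⟨_, _, ht⟩) _ _ z ht ?_ g]
  · exact (hs.apply_eq k hk (by rw [← e]; rfl)).symm
  · rw [hz, thetaComb, mul_add, ← map_mul, ← add_assoc, ← map_add, ← mul_assoc, ← map_mul]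
    ring_nf

end Torus

/-! ### Decompositions of the translates in the Hecke sum. -/

section Lines

variable {F : Type*} [Field F] {L : Type*} [CommRing L] [Algebra F L] [CharZero F] [ValuativeRel F]
  [TopologicalSpace F] [IsNonarchimedeanLocalField F] [TopologicalSpace L]
  {a b : 𝒪[F]} {c : 𝒪[F]ˣ} {δ : L} {Ω : Lˣ →ₜ* ℂˣ} {B : GL (Fin 2) F → ℂ}

/-- Units in 𝔬 + ϖ^m𝔬θ stabilize the coset of diag(ϖ^m, 1): conjugating the torus matrix by this
diagonal keeps it integral. This forces vanishing below the conductor. -/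
theorem apply_diagOne_of_unit (hB : B ∈ waldspurgerSpace (a : F) b (c : 𝒪[F]) δ Ω)
    (hs : IsSpherical B) {ϖ : Fˣ} {π : 𝒪[F]} (hπϖ : (π : F) = ϖ) (m : ℕ) (p r : 𝒪[F])
    (hN : IsUnit (normForm a b c p (π ^ m * r))) {z : Lˣ}
    (hz : (z : L) = thetaComb (b : F) δ p (π ^ m * r : 𝒪[F])) :
    B (diagOne (ϖ ^ m)) = Ω z * B (diagOne (ϖ ^ m)) := by
  refine spherical_torus_apply (coe_ne_zero_of_isUnit c.isUnit) hB hs hz ?_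
    !![p + π ^ m * r * b, r * c; -(π ^ (2 * m) * r * a), p] ?_ ?_
  · rw [normForm_coe]; exact coe_ne_zero_of_isUnit hN
  · convert hN using 1
    rw [Matrix.det_fin_two_of, normForm]; ring
  · rw [coe_diagOne]
    ext i j
    fin_cases i <;> fin_cases j <;>
      simp [Matrix.mul_apply, algebraMap_integer, hπϖ] <;> ring

theorem apply_diagOne_mul_upperTri (hB : B ∈ waldspurgerSpace (a : F) b (c : 𝒪[F]) δ Ω)
    (hs : IsSpherical B) {ϖ : Fˣ} {π : 𝒪[F]} (hπϖ : (π : F) = ϖ) (m : ℕ) (u : 𝒪[F])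
    (hN : IsUnit (normForm a b c 1 (π ^ m * (u * (c⁻¹ : 𝒪[F]ˣ))))) {z : Lˣ}
    (hz : (z : L) = thetaComb (b : F) δ 1 (π ^ m * (u * (c⁻¹ : 𝒪[F]ˣ)) : 𝒪[F])) :
    B (diagOne (ϖ ^ m) * upperTri ϖ 1 u) = Ω z * B (diagOne (ϖ ^ (m + 1))) := by
  have hcc : ((c : 𝒪[F]) : F) * ((c⁻¹ : 𝒪[F]ˣ) : 𝒪[F]) = 1 := by
    rw [← Subring.coe_mul, Units.mul_inv]; rfl
  refine spherical_torus_apply (coe_ne_zero_of_isUnit c.isUnit) hB hs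
    (p := ((1 : 𝒪[F]) : F)) hz ?_
    !![normForm a b c 1 (π ^ m * (u * (c⁻¹ : 𝒪[F]ˣ))), 0;
      -(π ^ (2 * m + 1) * u * (c⁻¹ : 𝒪[F]ˣ) * a), 1] ?_ ?_
  · rw [normForm_coe]; exact coe_ne_zero_of_isUnit hN
  · simpa [Matrix.det_fin_two_of] using hN
  · rw [coe_diagOne, Units.val_mul, coe_diagOne, coe_upperTri]
    ext i j
    fin_cases i <;> fin_cases j <;>
      simp [Matrix.mul_apply, algebraMap_integer, hπϖ, normForm]
    · linear_combination (-(a : F) * ϖ ^ (3 * m + 1) * u ^ 2 * ((c⁻¹ : 𝒪[F]ˣ) : 𝒪[F])) * hcc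
    · linear_combination (ϖ : F) ^ m * u * hcc
    · ring

theorem apply_diagOne_mul_center (hB : B ∈ waldspurgerSpace (a : F) b (c : 𝒪[F]) δ Ω)
    (hs : IsSpherical B) (ϖ : Fˣ) (m : ℕ) :
    B (diagOne (ϖ ^ (m + 1)) * upperTri 1 ϖ 0) =
      Ω (Units.map (algebraMap F L).toMonoidHom ϖ) * B (diagOne (ϖ ^ m)) := by
  refine spherical_torus_apply (p := (ϖ : F)) (r := 0) (coe_ne_zero_of_isUnit c.isUnit) hB hs
    (by rw [thetaComb_zero]; rfl) ?_ 1 (by simp) ?_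
  · simp [normForm]
  · rw [coe_diagOne, Units.val_mul, coe_diagOne, coe_upperTri]
    ext i j
    fin_cases i <;> fin_cases j <;> simp [Matrix.mul_apply, pow_succ, mul_comm]

theorem apply_upperTri_infty (hB : B ∈ waldspurgerSpace (a : F) b (c : 𝒪[F]) δ Ω)
    (hs : IsSpherical B) {ϖ : Fˣ} {π : 𝒪[F]} (hπϖ : (π : F) = ϖ) (ha : IsUnit a) {z : Lˣ}
    (hz : (z : L) = thetaComb (b : F) δ 0 1) :
    B (upperTri 1 ϖ 0) = Ω z * B (diagOne ϖ) := by
  refine spherical_torus_apply (p := 0) (r := 1) (coe_ne_zero_of_isUnit c.isUnit) hB hs hz ?_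
    !![b * π, c; -a, 0] ?_ ?_
  · simp [normForm, ha.ne_zero]
  · simpa [Matrix.det_fin_two_of] using ha
  · rw [coe_diagOne, coe_upperTri]
    ext i j
    fin_cases i <;> fin_cases j <;> simp [Matrix.mul_apply, algebraMap_integer, hπϖ, mul_comm]

/-- The two divisibilities are what makes `upperTri ϖ 1 u`⁻¹ times the matrix of p + rθ integral;
its determinant is N(p + rθ)/π = e, a unit. -/
theorem apply_upperTri_of_conjDvd (hB : B ∈ waldspurgerSpace (a : F) b (c : 𝒪[F]) δ Ω)
    (hs : IsSpherical B) {ϖ : Fˣ} {π : 𝒪[F]} (hπϖ : (π : F) = ϖ) {p r u : 𝒪[F]} (e : 𝒪[F]ˣ)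
    (he : normForm a b c p r = π * e) (h : ConjDvd π a b c p r 1 (u * (c⁻¹ : 𝒪[F]ˣ))) {z : Lˣ}
    (hz : (z : L) = thetaComb (b : F) δ p r) :
    B (upperTri ϖ 1 u) = Ω z * B 1 := by
  have hπ0 : π ≠ 0 := by
    rintro rfl
    exact ϖ.ne_zero hπϖ.symm
  have hcc : (c : 𝒪[F]) * (c⁻¹ : 𝒪[F]ˣ) = 1 := c.mul_inv
  obtain ⟨⟨t, ht⟩, ⟨s, hs'⟩⟩ := h
  refine spherical_torus_apply (coe_ne_zero_of_isUnit c.isUnit) hB hs hz ?_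
    !![t, -(s * c); -(r * a), p] ?_ ?_
  · rw [normForm_coe, he]; simp [hπ0]
  · convert e.isUnit using 1
    apply mul_left_cancel₀ hπ0
    rw [← he, Matrix.det_fin_two_of, normForm]
    linear_combination (-p) * ht + c * r * a * hs'
  · rw [coe_upperTri, ← hπϖ]
    ext i j
    fin_cases i <;> fin_cases j <;> simp [Matrix.mul_apply, algebraMap_integer] <;> norm_cast
    · linear_combination ht - u * r * a * hcc
    · linear_combination (-(c : 𝒪[F])) * hs' + u * p * hcc

theorem apply_upperTri_infty_of_conjDvd (hB : B ∈ waldspurgerSpace (a : F) b (c : 𝒪[F]) δ Ω)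
    (hs : IsSpherical B) {ϖ : Fˣ} {π : 𝒪[F]} (hπϖ : (π : F) = ϖ) {p r : 𝒪[F]} (e : 𝒪[F]ˣ)
    (he : normForm a b c p r = π * e) (h : ConjDvd π a b c p r 0 1) {z : Lˣ}
    (hz : (z : L) = thetaComb (b : F) δ p r) :
    B (upperTri 1 ϖ 0) = Ω z * B 1 := by
  have hπ0 : π ≠ 0 := by
    rintro rfl
    exact ϖ.ne_zero hπϖ.symm
  have hcc : (c : 𝒪[F]) * (c⁻¹ : 𝒪[F]ˣ) = 1 := c.mul_inv
  obtain ⟨⟨t, ht⟩, ⟨s, hs'⟩⟩ := h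
  refine spherical_torus_apply (coe_ne_zero_of_isUnit c.isUnit) hB hs hz ?_
    !![p + r * b, r * c; -(t * (c⁻¹ : 𝒪[F]ˣ)), s] ?_ ?_
  · rw [normForm_coe, he]; simp [hπ0]
  · convert e.isUnit using 1
    apply mul_left_cancel₀ hπ0
    rw [← he, Matrix.det_fin_two_of, normForm]
    linear_combination (-(p + r * b)) * hs' - r * c * (c⁻¹ : 𝒪[F]ˣ) * ht + a * c * r ^ 2 * hcc
  · rw [coe_upperTri, ← hπϖ]
    ext i j
    fin_cases i <;> fin_cases j <;> simp [Matrix.mul_apply, algebraMap_integer] <;> norm_cast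
    · linear_combination ((c⁻¹ : 𝒪[F]ˣ) : 𝒪[F]) * ht - r * a * hcc
    · linear_combination hs'

end Lines

/-! ### The recursion and its initial relation. -/

section Recursion

variable {F : Type*} [Field F] {L : Type*} [CommRing L] [Algebra F L] [CharZero F] [ValuativeRel F]
  [TopologicalSpace F] [IsNonarchimedeanLocalField F] [TopologicalSpace L]
  {a b : 𝒪[F]} {c : 𝒪[F]ˣ} {δ : L} {Ω : Lˣ →ₜ* ℂˣ} {B : GL (Fin 2) F → ℂ}

theorem hecke_recursion (hB : B ∈ waldspurgerSpace (a : F) b (c : 𝒪[F]) δ Ω)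
    (hs : IsSpherical B) (hδ : δ ^ 2 = algebraMap F L ((b : F) ^ 2 - 4 * a * (c : 𝒪[F])))
    {ϖ : Fˣ} {π : 𝒪[F]} (hπ : Irreducible π) (hπϖ : (π : F) = ϖ)
    [Fintype 𝓀[F]] (σ : 𝓀[F] → 𝒪[F]) {lam : ℂ}
    (hlam : ∀ g, ∑ x, B (g * upperTri ϖ 1 (σ x)) + B (g * upperTri 1 ϖ 0) = lam * B g) (m : ℕ)
    (htriv : ∀ (y : 𝒪[F]) (z : Lˣ), (z : L) = thetaComb (b : F) δ 1 (π ^ (m + 1) * y : 𝒪[F]) →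
      Ω z = 1) :
    lam * B (diagOne (ϖ ^ (m + 1))) = residueCard F * B (diagOne (ϖ ^ (m + 2))) +
      Ω (Units.map (algebraMap F L).toMonoidHom ϖ) * B (diagOne (ϖ ^ m)) := by
  rw [← hlam, apply_diagOne_mul_center hB hs]
  congr 1
  have : ∀ x, B (diagOne (ϖ ^ (m + 1)) * upperTri ϖ 1 (σ x)) = B (diagOne (ϖ ^ (m + 2))) := by
    intro x
    have hu : IsUnit (normForm a b c 1 (π ^ (m + 1) * (σ x * (c⁻¹ : 𝒪[F]ˣ)))) :=
      isUnit_normForm_of_dvd hπ _ _ _ ((dvd_pow_self π (by omega)).mul_right _)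
    obtain ⟨z, hz⟩ := exists_unit_eq_thetaComb_coe hδ hu.ne_zero
    rw [apply_diagOne_mul_upperTri hB hs hπϖ (m + 1) (σ x) hu hz, htriv _ z hz]
    simp
  rw [Finset.sum_congr rfl fun x _ => this x]
  simp [residueCard, Nat.card_eq_fintype_card]

/-- The Hecke relation at the identity, uniform in the splitting type of L. The family p i + (r i)θ
lists the elements of uniformizing norm, and `hbad` says that every primitive x + yθ of nonunit norm
is divisible by exactly one of them. -/
theorem hecke_recursion_zero (hB : B ∈ waldspurgerSpace (a : F) b (c : 𝒪[F]) δ Ω)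
    (hs : IsSpherical B) (hδ : δ ^ 2 = algebraMap F L ((b : F) ^ 2 - 4 * a * (c : 𝒪[F])))
    {ϖ : Fˣ} {π : 𝒪[F]} (hπ : Irreducible π) (hπϖ : (π : F) = ϖ)
    [Fintype 𝓀[F]] (σ : 𝓀[F] → 𝒪[F]) (hσ : ∀ x, IsLocalRing.residue 𝒪[F] (σ x) = x) {lam : ℂ}
    (hlam : ∀ g, ∑ x, B (g * upperTri ϖ 1 (σ x)) + B (g * upperTri 1 ϖ 0) = lam * B g)
    (htriv : ∀ (x y : 𝒪[F]) (z : Lˣ), IsUnit (normForm a b c x y) →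
      (z : L) = thetaComb (b : F) δ x y → Ω z = 1)
    {ι : Type*} [Fintype ι] (p r : ι → 𝒪[F]) (e : ι → 𝒪[F]ˣ)
    (he : ∀ i, normForm a b c (p i) (r i) = π * e i)
    (w : ι → Lˣ) (hw : ∀ i, (w i : L) = thetaComb (b : F) δ (p i) (r i))
    (hbad : ∀ x y : 𝒪[F], IsUnit x ∨ IsUnit y → π ∣ normForm a b c x y →
      ∃! i, ConjDvd π a b c (p i) (r i) x y) :
    lam * B 1 = (residueCard F + 1 - Fintype.card ι) * B (diagOne ϖ) + (∑ i, (Ω (w i) : ℂ)) * B 1 := by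
  classical
  -- Every translate gets the generic value B(diag(ϖ, 1)) plus a correction at the index dividing
  -- it. After exchanging the sums, `sum_conjDvd` shows that each index contributes its correction
  -- exactly once.
  have hval : ∀ (x y : 𝒪[F]) (v : ℂ), IsUnit x ∨ IsUnit y →
      (IsUnit (normForm a b c x y) → v = B (diagOne ϖ)) →
      (∀ i, ConjDvd π a b c (p i) (r i) x y → v = Ω (w i) * B 1) →
      v = B (diagOne ϖ) + ∑ i, if ConjDvd π a b c (p i) (r i) x y then
        Ω (w i) * B 1 - B (diagOne ϖ) else 0 := by
    intro x y v hxy h1 h2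
    rcases isUnit_or_dvd hπ (normForm a b c x y) with h | h
    · rw [Finset.sum_eq_zero, add_zero, h1 h]
      intro i _
      rw [if_neg]
      intro hi
      exact hπ.not_isUnit (isUnit_of_dvd_unit (hi.dvd_normForm hπ (e i) (he i)) h)
    · obtain ⟨i, hi, huniq⟩ := hbad x y hxy h
      rw [Finset.sum_eq_single i, if_pos hi, h2 i hi, add_sub_cancel]
      · intro j _ hji
        rw [if_neg]
        exact fun hj => hji (huniq j hj)
      · simp
  have hfin : ∀ x, B (1 * upperTri ϖ 1 (σ x)) = B (diagOne ϖ) +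
      ∑ i, if ConjDvd π a b c (p i) (r i) 1 (σ x * (c⁻¹ : 𝒪[F]ˣ)) then
        Ω (w i) * B 1 - B (diagOne ϖ) else 0 := by
    intro x
    rw [one_mul]
    apply hval _ _ _ (Or.inl isUnit_one)
    · intro hu
      obtain ⟨z, hz⟩ := exists_unit_eq_thetaComb_coe hδ hu.ne_zero
      have h1 := htriv _ _ z hu hz
      have := apply_diagOne_mul_upperTri hB hs hπϖ 0 (σ x) (by simpa using hu) (z := z)
        (by simpa using hz)
      have h2 : (diagOne (ϖ ^ 0) : GL (Fin 2) F) = 1 := by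
        ext i j
        rw [coe_diagOne]
        fin_cases i <;> fin_cases j <;> simp
      rw [h2, h1, zero_add, pow_one] at this
      simpa using this
    · intro i hi
      exact apply_upperTri_of_conjDvd hB hs hπϖ (e i) (he i) hi (hw i)
  have hinf : B (1 * upperTri 1 ϖ 0) = B (diagOne ϖ) +
      ∑ i, if ConjDvd π a b c (p i) (r i) 0 1 then
        Ω (w i) * B 1 - B (diagOne ϖ) else 0 := by
    rw [one_mul]
    apply hval _ _ _ (Or.inr isUnit_one)
    · intro hu
      obtain ⟨z, hz⟩ := exists_unit_eq_thetaComb_coe hδ hu.ne_zero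
      have h1 := htriv _ _ z hu hz
      have ha : IsUnit a := by
        have h3 : normForm a b c 0 1 = a * c := by simp [normForm]
        rw [h3] at hu
        exact isUnit_of_mul_isUnit_left hu
      rw [apply_upperTri_infty hB hs hπϖ ha (z := z) (by simpa using hz), h1]
      simp
    · intro i hi
      exact apply_upperTri_infty_of_conjDvd hB hs hπϖ (e i) (he i) hi (hw i)
  rw [← hlam, hinf, Finset.sum_congr rfl fun x _ => hfin x, Finset.sum_add_distrib,
    Finset.sum_comm, add_add_add_comm, ← Finset.sum_add_distrib,
    Finset.sum_congr rfl fun i _ => sum_conjDvd hπ σ hσ a b c (p i) (r i) (e i) (he i) _]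
  simp only [Finset.sum_sub_distrib, ← Finset.sum_mul, Finset.sum_const, Finset.card_univ,
    nsmul_eq_mul, residueCard, Nat.card_eq_fintype_card]
  ring

end Recursion

/-! ### The integral basis 1, θ of 𝔬_L. -/

section Theta

variable {F : Type*} [Field F] {L : Type*} [CommRing L] [Algebra F L]

/-- `1, θ` is a basis of `L` over `F`, and `𝔬 + 𝔬 θ` is the ring of integers of `L`. -/
structure IsIntegralTheta [ValuativeRel F] (b : F) (δ : L) : Prop where
  surj : ∀ z : L, ∃ x y : F, z = thetaComb b δ x y
  inj : ∀ x y p r : F, thetaComb b δ x y = thetaComb b δ p r → x = p ∧ y = r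
  integral : ∀ x y : F, thetaComb b δ x y ∈ integersOf F L → x ∈ 𝒪[F] ∧ y ∈ 𝒪[F]

theorem thetaComb_add (b : F) (δ : L) (x y p r : F) :
    thetaComb b δ x y + thetaComb b δ p r = thetaComb b δ (x + p) (y + r) := by
  simp only [thetaComb, map_add]; ring

theorem thetaComb_sub (b : F) (δ : L) (x y p r : F) :
    thetaComb b δ x y - thetaComb b δ p r = thetaComb b δ (x - p) (y - r) := by
  simp only [thetaComb, map_sub]; ring

theorem algebraMap_mul_thetaComb (b : F) (δ : L) (t x y : F) :
    algebraMap F L t * thetaComb b δ x y = thetaComb b δ (t * x) (t * y) := by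
  simp only [thetaComb, map_mul]; ring

theorem thetaComb_one (b : F) (δ : L) : thetaComb b δ 1 0 = 1 := by
  simp [thetaComb]

theorem IsQuadraticAlgebra.nontrivial {d : F} {δ : L} (hL : IsQuadraticAlgebra d δ) :
    Nontrivial L := by
  by_cases h : IsSquare d
  · obtain ⟨e, -, -⟩ := hL.split h
    exact e.toEquiv.nontrivial
  · exact (hL.field h).1.nontrivial

variable [CharZero F]

theorem delta_eq_thetaComb (b : F) (δ : L) : δ = thetaComb b δ (-b) 2 := by
  have h1 : algebraMap F L 2 * algebraMap F L (1 / 2) = 1 := by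
    rw [← map_mul]; simp
  rw [thetaComb, mul_add, ← map_mul, ← mul_assoc, h1, mul_div_cancel₀ _ two_ne_zero, map_neg]
  ring

theorem IsQuadraticAlgebra.exists_thetaComb {d : F} {δ : L} (hL : IsQuadraticAlgebra d δ)
    (hd : d ≠ 0) (b : F) (z : L) : ∃ x y : F, z = thetaComb b δ x y := by
  suffices ∃ x y : F, z = algebraMap F L x + algebraMap F L y * δ by
    obtain ⟨x, y, rfl⟩ := this
    refine ⟨x + y * -b, y * 2, ?_⟩
    nth_rewrite 1 [delta_eq_thetaComb b δ]
    rw [algebraMap_mul_thetaComb, ← thetaComb_zero b δ x, thetaComb_add, zero_add]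
  by_cases h : IsSquare d
  · obtain ⟨e, s, hs⟩ := hL.split h
    have hs0 : s ≠ 0 := by
      rintro rfl
      have h1 := congrArg e hL.sq_eq
      rw [map_pow, hs, AlgEquiv.commutes] at h1
      have h2 := congrArg Prod.fst h1
      simp at h2
      exact hd h2.symm
    refine ⟨((e z).1 + (e z).2) / 2, ((e z).1 - (e z).2) / (2 * s), ?_⟩
    apply e.injective
    rw [map_add, map_mul, AlgEquiv.commutes, AlgEquiv.commutes, hs]
    ext
    · simp; field_simp; ring
    · simp; field_simp; ring
  · have hz : z ∈ Algebra.adjoin F {δ} := by rw [(hL.field h).2]; trivial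
    induction hz using Algebra.adjoin_induction with
    | mem x hx => exact ⟨0, 1, by rw [Set.mem_singleton_iff.mp hx]; simp⟩
    | algebraMap r => exact ⟨r, 0, by simp⟩
    | add x y _ _ hx hy =>
      obtain ⟨x, p, rfl⟩ := hx
      obtain ⟨y, r, rfl⟩ := hy
      exact ⟨x + y, p + r, by simp only [map_add]; ring⟩
    | mul x y _ _ hx hy =>
      obtain ⟨x, p, rfl⟩ := hx
      obtain ⟨y, r, rfl⟩ := hy
      refine ⟨x * y + p * r * d, x * r + p * y, ?_⟩
      have := hL.sq_eq
      simp only [map_add, map_mul]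
      linear_combination algebraMap F L p * algebraMap F L r * this

theorem IsQuadraticAlgebra.thetaComb_inj {d : F} {δ : L} (hL : IsQuadraticAlgebra d δ)
    (hd : d ≠ 0) (b x y p r : F) (h : thetaComb b δ x y = thetaComb b δ p r) :
    x = p ∧ y = r := by
  have := hL.nontrivial
  have hinj : Function.Injective (algebraMap F L) := (algebraMap F L).injective
  have hδ : ∀ t : F, δ ≠ algebraMap F L t := by
    intro t ht
    have h1 : d = t ^ 2 := by
      apply hinj
      rw [← hL.sq_eq, ht, map_pow]
    obtain ⟨e, s, hs⟩ := hL.split ⟨t, h1.trans (sq t)⟩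
    rw [ht, AlgEquiv.commutes] at hs
    have h2 := congrArg Prod.fst hs
    have h3 := congrArg Prod.snd hs
    simp at h2 h3
    have h4 : t = 0 := by
      have : (2 : F) * t = 0 := by linear_combination h2 + h3
      simpa using this
    apply hd
    rw [h1, h4]; simp
  have hy : y = r := by
    by_contra hne
    have hyr : y - r ≠ 0 := sub_ne_zero.mpr hne
    apply hδ ((p - x) / (y - r) * 2 - b)
    have h1 : algebraMap F L (y - r) * algebraMap F L (b / 2) +
        algebraMap F L (y - r) * algebraMap F L (1 / 2) * δ = algebraMap F L (p - x) := by
      simp only [thetaComb] at h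
      simp only [map_sub]
      linear_combination h
    have h2 := congrArg (algebraMap F L (2 / (y - r)) * ·) h1
    simp only [mul_add, ← mul_assoc, ← map_mul] at h2
    rw [show 2 / (y - r) * (y - r) * (1 / 2) = 1 by field_simp, map_one, one_mul,
      show 2 / (y - r) * (y - r) * (b / 2) = b by field_simp] at h2
    rw [map_sub, eq_sub_iff_add_eq, add_comm, h2]
    congr 1
    ring
  subst hy
  refine ⟨hinj ?_, rfl⟩
  simpa [thetaComb] using h

theorem trace_thetaComb {a b c : F} {δ : L}
    (hL : IsQuadraticAlgebra (b ^ 2 - 4 * a * c) δ) (hd : b ^ 2 - 4 * a * c ≠ 0) (x y : F) :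
    Algebra.trace F L (thetaComb b δ x y) = 2 * x + y * b := by
  let f : (Fin 2 → F) →ₗ[F] L :=
    { toFun := fun v => thetaComb b δ (v 0) (v 1)
      map_add' := fun v w => by rw [thetaComb_add]; rfl
      map_smul' := fun t v => by
        rw [RingHom.id_apply, Algebra.smul_def t (thetaComb _ _ _ _), algebraMap_mul_thetaComb]; rfl }
  have hf : Function.Bijective f := by
    constructor
    · intro v w hvw
      obtain ⟨h0, h1⟩ := hL.thetaComb_inj hd b _ _ _ _ hvw
      ext i; fin_cases i
      · exact h0
      · exact h1
    · intro z
      obtain ⟨x, y, rfl⟩ := hL.exists_thetaComb hd b z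
      exact ⟨![x, y], rfl⟩
  let e := LinearEquiv.ofBijective f hf
  have he : ∀ x y, e.symm (thetaComb b δ x y) = ![x, y] := by
    intro x y
    rw [LinearEquiv.symm_apply_eq]
    rfl
  let β : Module.Basis (Fin 2) F L := Module.Basis.ofEquivFun e.symm
  have hβ0 : β 0 = thetaComb b δ 1 0 := by
    rw [Module.Basis.coe_ofEquivFun]
    simp [e, f]
  have hβ1 : β 1 = thetaComb b δ 0 1 := by
    rw [Module.Basis.coe_ofEquivFun]
    simp [e, f]
  rw [Algebra.trace_eq_matrix_trace β, Matrix.trace_fin_two, Algebra.leftMulMatrix_eq_repr_mul,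
    Algebra.leftMulMatrix_eq_repr_mul, hβ0, hβ1, thetaComb_mul hL.sq_eq, thetaComb_mul hL.sq_eq]
  have hr : ∀ z i, β.repr z i = e.symm z i := fun z i => by
    rw [← Module.Basis.equivFun_apply, Module.Basis.equivFun_ofEquivFun]
  rw [hr, hr, he, he]
  simp
  ring

theorem discr_one_thetaComb {a b c : F} {δ : L}
    (hL : IsQuadraticAlgebra (b ^ 2 - 4 * a * c) δ) (hd : b ^ 2 - 4 * a * c ≠ 0) (x y : F) :
    Algebra.discr F ![1, thetaComb b δ x y] = y ^ 2 * (b ^ 2 - 4 * a * c) := by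
  rw [Algebra.discr_def, Matrix.det_fin_two]
  simp only [Algebra.traceMatrix_apply, Algebra.traceForm_apply, Matrix.cons_val_zero,
    Matrix.cons_val_one, one_mul, mul_one]
  rw [thetaComb_mul hL.sq_eq, trace_thetaComb hL hd, trace_thetaComb hL hd, ← thetaComb_one b δ,
    trace_thetaComb hL hd]
  ring

section Integral

variable [ValuativeRel F] [TopologicalSpace F] [IsNonarchimedeanLocalField F]

omit [CharZero F] [TopologicalSpace F] [IsNonarchimedeanLocalField F] in
theorem mem_integer_of_isIntegral {x : F} (h : IsIntegral 𝒪[F] x) : x ∈ 𝒪[F] := by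
  obtain ⟨y, rfl⟩ := IsIntegrallyClosed.isIntegral_iff.mp h
  exact y.2

omit [CharZero F] [TopologicalSpace F] [IsNonarchimedeanLocalField F] in
theorem mem_integer_of_sq_mem {x : F} (h : x ^ 2 ∈ 𝒪[F]) : x ∈ 𝒪[F] := by
  have h' : valuation F (x ^ 2) ≤ 1 := h
  rw [map_pow] at h'
  exact (pow_le_one_iff two_ne_zero).mp h'

omit [TopologicalSpace F] [IsNonarchimedeanLocalField F] in
theorem isIntegral_theta {a b c : 𝒪[F]} {δ : L}
    (hδ : δ ^ 2 = algebraMap F L ((b : F) ^ 2 - 4 * a * c)) :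
    IsIntegral 𝒪[F] (thetaComb (b : F) δ 0 1) := by
  refine ⟨Polynomial.X ^ 2 - Polynomial.C b * Polynomial.X + Polynomial.C (a * c), ?_, ?_⟩
  · monicity!
  · have h1 := thetaComb_mul hδ 0 1 0 1
    have h2 : ∀ t : 𝒪[F], algebraMap 𝒪[F] L t = algebraMap F L t := fun t => rfl
    simp only [Polynomial.eval₂_add, Polynomial.eval₂_sub, Polynomial.eval₂_pow,
      Polynomial.eval₂_mul, Polynomial.eval₂_X, Polynomial.eval₂_C, h2]
    rw [sq, h1, algebraMap_mul_thetaComb, thetaComb_sub, ← thetaComb_zero (b : F) δ, thetaComb_add]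
    simp [thetaComb]

omit [TopologicalSpace F] [IsNonarchimedeanLocalField F] in
theorem thetaComb_mem_integersOf {a b c : 𝒪[F]} {δ : L}
    (hδ : δ ^ 2 = algebraMap F L ((b : F) ^ 2 - 4 * a * c)) (x y : 𝒪[F]) :
    thetaComb (b : F) δ x y ∈ integersOf F L := by
  have h : thetaComb (b : F) δ x y =
      algebraMap 𝒪[F] L x + algebraMap 𝒪[F] L y * thetaComb (b : F) δ 0 1 := by
    change _ = algebraMap F L x + algebraMap F L y * _
    simp [thetaComb]
  rw [h]
  exact (isIntegral_algebraMap).add ((isIntegral_algebraMap).mul (isIntegral_theta hδ))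

omit [TopologicalSpace F] [IsNonarchimedeanLocalField F] in
-- For integral x + yθ only y needs work, since then x = (x + yθ) - yθ is integral. In the split
-- case the two components differ by ys with s² = d a unit.
theorem IsQuadraticAlgebra.isIntegralTheta {a b c : 𝒪[F]} {δ : L}
    (hd : (b : F) ^ 2 - 4 * a * c ≠ 0) (hL : IsQuadraticAlgebra ((b : F) ^ 2 - 4 * a * c) δ)
    (hdisc : ¬ IsSquare ((b : F) ^ 2 - 4 * a * c) →
      discriminant F L = Submodule.span 𝒪[F] {(b : F) ^ 2 - 4 * a * c})
    (hunit : IsSquare ((b : F) ^ 2 - 4 * a * c) →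
      ∃ u : 𝒪[F]ˣ, ((u : 𝒪[F]) : F) = (b : F) ^ 2 - 4 * a * c) :
    IsIntegralTheta (b : F) δ where
  surj := hL.exists_thetaComb hd _
  inj := hL.thetaComb_inj hd _
  integral x y h := by
    have := hL.nontrivial
    have hy : y ∈ 𝒪[F] := by
      by_cases hsq : IsSquare ((b : F) ^ 2 - 4 * a * c)
      · obtain ⟨e, s, hs⟩ := hL.split hsq
        obtain ⟨u, hu⟩ := hunit hsq
        have hsd : s ^ 2 = (b : F) ^ 2 - 4 * a * c := by
          have h1 := congrArg e hL.sq_eq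
          rw [map_pow, hs, AlgEquiv.commutes] at h1
          simpa using congrArg Prod.fst h1
        have hvs : valuation F s = 1 := by
          have h2 : valuation F (s ^ 2) = 1 := by
            rw [hsd, ← hu]
            exact (Valuation.integer.integers (valuation F)).isUnit_iff_valuation_eq_one.mp u.isUnit
          rw [map_pow] at h2
          exact (pow_eq_one_iff_of_nonneg (by simp) two_ne_zero).mp h2
        have h1 : (e (thetaComb (b : F) δ x y)).1 ∈ 𝒪[F] := mem_integer_of_isIntegral
          (IsIntegral.map (((AlgHom.fst F F F).comp e.toAlgHom).restrictScalars 𝒪[F]) h)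
        have h2 : (e (thetaComb (b : F) δ x y)).2 ∈ 𝒪[F] := mem_integer_of_isIntegral
          (IsIntegral.map (((AlgHom.snd F F F).comp e.toAlgHom).restrictScalars 𝒪[F]) h)
        have h3 : y * s ∈ 𝒪[F] := by
          convert sub_mem h1 h2 using 1
          simp only [thetaComb, map_add, map_mul, AlgEquiv.commutes, hs]
          simp
          ring
        have h4 : valuation F (y * s) ≤ 1 := h3
        rwa [map_mul, hvs, mul_one] at h4
      -- The pair (1, x + yθ) has discriminant y²d, which lies in d𝔬 by hypothesis; so y² is
      -- integral, and hence y is.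
      · have h1 : Algebra.discr F ![1, thetaComb (b : F) δ x y] ∈ discriminant F L := by
          apply Submodule.subset_span
          refine ⟨![1, ⟨_, h⟩], ?_⟩
          congr 1
          ext i
          fin_cases i <;> simp
        rw [discr_one_thetaComb hL hd, hdisc hsq, Submodule.mem_span_singleton] at h1
        obtain ⟨t, ht⟩ := h1
        apply mem_integer_of_sq_mem
        have h2 : (t : F) = y ^ 2 := mul_right_cancel₀ hd ht
        rw [← h2]
        exact t.2
    refine ⟨?_, hy⟩
    have h1 : IsIntegral 𝒪[F] (algebraMap F L x) := by
      have h2 := IsIntegral.sub (show IsIntegral 𝒪[F] _ from h)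
        (show IsIntegral 𝒪[F] _ from thetaComb_mem_integersOf hL.sq_eq 0 ⟨y, hy⟩)
      rw [thetaComb_sub] at h2
      simpa [thetaComb_zero] using h2
    exact mem_integer_of_isIntegral
      ((isIntegral_algebraMap_iff (algebraMap F L).injective).mp h1)

omit [CharZero F] [TopologicalSpace F] [IsNonarchimedeanLocalField F] in
theorem IsIntegralTheta.exists_eq {b : F} {δ : L} (h : IsIntegralTheta b δ) (u : integersOf F L) :
    ∃ x y : 𝒪[F], (u : L) = thetaComb b δ x y := by
  obtain ⟨x, y, hxy⟩ := h.surj u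
  obtain ⟨hx, hy⟩ := h.integral x y (hxy ▸ u.2)
  exact ⟨⟨x, hx⟩, ⟨y, hy⟩, hxy⟩

theorem normForm_mul {R : Type*} [CommRing R] (a b c x y p r : R) :
    normForm a b c (x * p - y * r * (a * c)) (x * r + y * p + y * r * b) =
      normForm a b c x y * normForm a b c p r := by
  simp only [normForm]; ring

omit [TopologicalSpace F] [IsNonarchimedeanLocalField F] in
theorem IsIntegralTheta.normForm_eq_mul {a b c : 𝒪[F]} {δ : L} (h : IsIntegralTheta (b : F) δ)
    (hδ : δ ^ 2 = algebraMap F L ((b : F) ^ 2 - 4 * a * c)) {x y p r s t : 𝒪[F]}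
    (he : thetaComb (b : F) δ x y * thetaComb (b : F) δ p r = thetaComb (b : F) δ s t) :
    normForm a b c s t = normForm a b c x y * normForm a b c p r := by
  rw [thetaComb_mul hδ] at he
  obtain ⟨h1, h2⟩ := h.inj _ _ _ _ he
  rw [← normForm_mul]
  congr 1 <;> apply Subtype.ext <;> simp [← h1, ← h2]

omit [TopologicalSpace F] [IsNonarchimedeanLocalField F] in
/-- An element of `𝔬_L` is a unit if and only if its norm is a unit. -/
theorem IsIntegralTheta.isUnit_iff {a b c : 𝒪[F]} {δ : L} (h : IsIntegralTheta (b : F) δ)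
    (hδ : δ ^ 2 = algebraMap F L ((b : F) ^ 2 - 4 * a * c)) {u : integersOf F L} {x y : 𝒪[F]}
    (hu : (u : L) = thetaComb (b : F) δ x y) : IsUnit u ↔ IsUnit (normForm a b c x y) := by
  constructor
  · rw [isUnit_iff_exists_inv]
    rintro ⟨v, hv⟩
    obtain ⟨p, r, hpr⟩ := h.exists_eq v
    have h1 : thetaComb (b : F) δ x y * thetaComb (b : F) δ p r =
        thetaComb (b : F) δ (1 : 𝒪[F]) (0 : 𝒪[F]) := by
      rw [← hu, ← hpr, ← Subalgebra.coe_mul, hv]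
      simp [thetaComb_one]
    have h2 := h.normForm_eq_mul hδ h1
    have h3 : normForm a b c 1 0 = 1 := by simp [normForm]
    exact isUnit_iff_exists_inv.mpr ⟨_, h2.symm.trans h3⟩
  · rintro ⟨n, hn⟩
    rw [isUnit_iff_exists_inv]
    refine ⟨⟨_, thetaComb_mem_integersOf hδ (x + y * b) (-y)⟩ *
      algebraMap 𝒪[F] (integersOf F L) (n⁻¹ : 𝒪[F]ˣ), ?_⟩
    apply Subtype.ext
    have h1 := thetaComb_mul_conj hδ (x : F) y
    rw [normForm_coe, ← hn] at h1
    have h2 : algebraMap F L ((n : 𝒪[F]) : F) * algebraMap F L ((n⁻¹ : 𝒪[F]ˣ) : 𝒪[F]) = 1 := by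
      rw [← map_mul, ← Subring.coe_mul, Units.mul_inv]; simp
    rw [Subalgebra.coe_mul, Subalgebra.coe_mul, hu, ← mul_assoc]
    push_cast
    rw [h1]
    exact h2

omit [CharZero F] in
theorem primeExt_pow {π : 𝒪[F]} (hπ : Irreducible π) (m : ℕ) :
    primeExt F L ^ m = Ideal.span {algebraMap 𝒪[F] (integersOf F L) (π ^ m)} := by
  rw [primeExt, hπ.maximalIdeal_eq, Ideal.map_span, Set.image_singleton,
    Ideal.span_singleton_pow, map_pow]

theorem IsIntegralTheta.mem_primeExt_pow {a b c : 𝒪[F]} {δ : L} (h : IsIntegralTheta (b : F) δ)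
    (hδ : δ ^ 2 = algebraMap F L ((b : F) ^ 2 - 4 * a * c)) {π : 𝒪[F]} (hπ : Irreducible π)
    {m : ℕ} {u : integersOf F L} {x y : 𝒪[F]} (hu : (u : L) = thetaComb (b : F) δ x y) :
    u ∈ primeExt F L ^ m ↔ π ^ m ∣ x ∧ π ^ m ∣ y := by
  rw [primeExt_pow hπ, Ideal.mem_span_singleton]
  have hval : ∀ (t : 𝒪[F]) (v : integersOf F L),
      ((algebraMap 𝒪[F] (integersOf F L) t * v : integersOf F L) : L) = algebraMap F L t * v :=
    fun _ _ => rfl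
  constructor
  · rintro ⟨v, rfl⟩
    obtain ⟨p, r, hpr⟩ := h.exists_eq v
    rw [hval, hpr, algebraMap_mul_thetaComb] at hu
    obtain ⟨h1, h2⟩ := h.inj _ _ _ _ hu
    exact ⟨⟨p, Subtype.ext h1.symm⟩, ⟨r, Subtype.ext h2.symm⟩⟩
  · rintro ⟨⟨p, rfl⟩, ⟨r, rfl⟩⟩
    refine ⟨⟨_, thetaComb_mem_integersOf hδ p r⟩, Subtype.ext ?_⟩
    rw [hval, hu, algebraMap_mul_thetaComb]
    simp

end Integral

/-! ### Existence of the conductor. -/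

section Conductor

/-- ℂˣ has no small subgroups: while w stays within 1/2 of 1, |w + 1| ≥ 3/2, so each squaring
multiplies the distance to 1 by at least 3/2. -/
theorem eq_one_of_pow_two_pow_near_one {w : ℂ} (h : ∀ k : ℕ, ‖w ^ 2 ^ k - 1‖ ≤ 1 / 2) : w = 1 := by
  have hgrow : ∀ k : ℕ, (3 / 2 : ℝ) ^ k * ‖w - 1‖ ≤ ‖w ^ 2 ^ k - 1‖ := by
    intro k
    induction k with
    | zero => simp
    | succ k ih =>
      have h1 : w ^ 2 ^ (k + 1) - 1 = (w ^ 2 ^ k - 1) * (w ^ 2 ^ k + 1) := by ring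
      have h2 : (3 / 2 : ℝ) ≤ ‖w ^ 2 ^ k + 1‖ := by
        have h3 : ‖(2 : ℂ)‖ ≤ ‖w ^ 2 ^ k + 1‖ + ‖w ^ 2 ^ k - 1‖ := by
          rw [show (2 : ℂ) = (w ^ 2 ^ k + 1) - (w ^ 2 ^ k - 1) by ring]
          exact norm_sub_le _ _
        have h4 := h k
        rw [Complex.norm_ofNat] at h3
        linarith
      rw [h1, norm_mul, pow_succ]
      calc (3 / 2 : ℝ) ^ k * (3 / 2) * ‖w - 1‖ = ((3 / 2 : ℝ) ^ k * ‖w - 1‖) * (3 / 2) := by ring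
        _ ≤ _ := by gcongr
  by_contra hw
  have hpos : 0 < ‖w - 1‖ := norm_pos_iff.mpr (sub_ne_zero.mpr hw)
  obtain ⟨k, hk⟩ := pow_unbounded_of_one_lt (1 / ‖w - 1‖) (show (1 : ℝ) < 3 / 2 by norm_num)
  rw [div_lt_iff₀ hpos] at hk
  linarith [hgrow k, h k]

variable [ValuativeRel F] [TopologicalSpace F] [IsNonarchimedeanLocalField F]

omit [CharZero F] in
theorem exists_pow_mul_mem_of_mem_nhds {π : 𝒪[F]} (hπ : Irreducible π) {U : Set F}
    (hU : U ∈ nhds (0 : F)) : ∃ n : ℕ, ∀ t : 𝒪[F], ((π ^ n * t : 𝒪[F]) : F) ∈ U := by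
  obtain ⟨γ, hγ, hγU⟩ := (IsValuativeTopology.hasBasis_nhds_zero' F).mem_iff.mp hU
  have : MulArchimedean (ValueGroupWithZero F) :=
    ValuativeRel.isRankLeOne_iff_mulArchimedean.mp inferInstance
  have hlt : valuation F (π : F) < 1 :=
    (Valuation.integer.integers (valuation F)).valuation_irreducible_lt_one hπ
  obtain ⟨n, hn⟩ := exists_pow_lt₀ hlt (Units.mk0 γ hγ)
  refine ⟨n, fun t => hγU ?_⟩
  change valuation F _ < γ
  have ht : valuation F (t : F) ≤ 1 := t.2
  rw [Subring.coe_mul, map_mul, Subring.coe_pow, map_pow]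
  exact (mul_le_of_le_one_right (by simp) ht).trans_lt hn

/-- Continuity puts Ω within 1/2 of 1 on units congruent to 1 modulo a high power of 𝔓_L. These are
closed under powers, so the absence of small subgroups makes Ω trivial on them. -/
theorem IsIntegralTheta.exists_trivial [TopologicalSpace L] [IsModuleTopology F L]
    {a b c : 𝒪[F]} {δ : L} (h : IsIntegralTheta (b : F) δ)
    (hδ : δ ^ 2 = algebraMap F L ((b : F) ^ 2 - 4 * a * c)) (Ω : Lˣ →ₜ* ℂˣ) :
    ∃ m : ℕ, ∀ u : (integersOf F L)ˣ, (u : integersOf F L) - 1 ∈ primeExt F L ^ m →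
      Ω (Units.map (algebraMap (integersOf F L) L).toMonoidHom u) = 1 := by
  obtain ⟨π, hπ⟩ := IsDiscreteValuationRing.exists_irreducible 𝒪[F]
  have : ContinuousAdd L := IsModuleTopology.toContinuousAdd F L
  have : ContinuousSMul F L := IsModuleTopology.toContinuousSMul F L
  let f : F × F →ₗ[F] L :=
    { toFun := fun v => thetaComb (b : F) δ v.1 v.2
      map_add' := fun v w => by rw [thetaComb_add]; rfl
      map_smul' := fun t v => by
        rw [RingHom.id_apply, Algebra.smul_def t (thetaComb _ _ _ _), algebraMap_mul_thetaComb]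
        rfl }
  have hf : Continuous f := IsModuleTopology.continuous_of_linearMap f
  have hf1 : f (1, 0) = 1 := thetaComb_one _ _
  have hV : {z : Lˣ | ‖(Ω z : ℂ) - 1‖ < 1 / 2} ∈ nhds (1 : Lˣ) := by
    apply IsOpen.mem_nhds
    · exact isOpen_lt (((Units.continuous_val.comp Ω.continuous_toFun).sub
        continuous_const).norm) continuous_const
    · simp
  have hnear : ∀ U ∈ nhds (1 : L), ∃ n : ℕ, ∀ m, n ≤ m → ∀ u : integersOf F L,
      u - 1 ∈ primeExt F L ^ m → (u : L) ∈ U := by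
    intro U hU
    have h1 : f ⁻¹' U ∈ nhds ((1, 0) : F × F) := hf.continuousAt.preimage_mem_nhds (by rwa [hf1])
    rw [nhds_prod_eq] at h1
    obtain ⟨U₁, hU₁, U₂, hU₂, hU⟩ := Filter.mem_prod_iff.mp h1
    have hU₁' : (fun x : F => 1 + x) ⁻¹' U₁ ∈ nhds (0 : F) := by
      apply (continuous_const.add continuous_id).continuousAt.preimage_mem_nhds
      simpa using hU₁
    obtain ⟨n₁, hn₁⟩ := exists_pow_mul_mem_of_mem_nhds hπ hU₁'
    obtain ⟨n₂, hn₂⟩ := exists_pow_mul_mem_of_mem_nhds hπ hU₂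
    refine ⟨max n₁ n₂, fun m hm u hu => ?_⟩
    obtain ⟨x, y, hxy⟩ := h.exists_eq (u - 1)
    obtain ⟨⟨s, hs⟩, ⟨t, ht⟩⟩ := (h.mem_primeExt_pow hδ hπ hxy).mp hu
    have hu1 : (u : L) = f (1 + x, y) := by
      change _ = thetaComb _ _ _ _
      have : (u : L) = 1 + ((u - 1 : integersOf F L) : L) := by simp
      rw [this, hxy, ← thetaComb_one (b : F) δ, thetaComb_add, zero_add]
    rw [hu1]
    apply hU
    refine ⟨?_, ?_⟩
    · have := hn₁ (π ^ (m - n₁) * s)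
      rwa [← mul_assoc, ← pow_add, Nat.add_sub_cancel' ((le_max_left _ _).trans hm), ← hs] at this
    · have := hn₂ (π ^ (m - n₂) * t)
      rwa [← mul_assoc, ← pow_add, Nat.add_sub_cancel' ((le_max_right _ _).trans hm), ← ht] at this
  rw [Units.isEmbedding_embedProduct.nhds_eq_comap, Filter.mem_comap] at hV
  obtain ⟨U, hU, hUV⟩ := hV
  rw [map_one, Prod.one_eq_mk, nhds_prod_eq] at hU
  obtain ⟨U₁, hU₁, U₂, hU₂, hU⟩ := Filter.mem_prod_iff.mp hU
  obtain ⟨n₁, hn₁⟩ := hnear U₁ hU₁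
  obtain ⟨n₂, hn₂⟩ := hnear (MulOpposite.op ⁻¹' U₂)
    (MulOpposite.continuous_op.continuousAt.preimage_mem_nhds hU₂)
  have hsmall : ∀ u : (integersOf F L)ˣ,
      (u : integersOf F L) - 1 ∈ primeExt F L ^ (max n₁ n₂) →
      ‖(Ω (Units.map (algebraMap (integersOf F L) L).toMonoidHom u) : ℂ) - 1‖ < 1 / 2 := by
    intro u hu
    apply hUV
    apply hU
    refine ⟨hn₁ (max n₁ n₂) (le_max_left _ _) _ hu, hn₂ (max n₁ n₂) (le_max_right _ _) (u⁻¹ : (integersOf F L)ˣ) ?_⟩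
    -- The topology on Lˣ also controls inverses, so u⁻¹ must be shown close to 1 as well.
    have : ((u⁻¹ : (integersOf F L)ˣ) : integersOf F L) - 1 =
        -((u⁻¹ : (integersOf F L)ˣ) : integersOf F L) * ((u : integersOf F L) - 1) := by
      linear_combination Units.inv_mul u
    rw [this]
    exact Ideal.mul_mem_left _ _ hu
  refine ⟨max n₁ n₂, fun u hu => ?_⟩
  apply Units.ext
  apply eq_one_of_pow_two_pow_near_one
  intro k
  have hk : ((u ^ 2 ^ k : (integersOf F L)ˣ) : integersOf F L) - 1 ∈
      primeExt F L ^ (max n₁ n₂) := by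
    rw [Units.val_pow_eq_pow_val]
    have := sub_dvd_pow_sub_pow (u : integersOf F L) 1 (2 ^ k)
    rw [one_pow] at this
    exact Ideal.mem_of_dvd _ this hu
  have := hsmall _ hk
  rw [map_pow, map_pow, Units.val_pow_eq_pow_val] at this
  exact this.le

end Conductor

end Theta

/-! ### Behaviour of Ω and B at and below the conductor. -/

section Conductor

variable {F : Type*} [Field F] {L : Type*} [CommRing L] [Algebra F L] [CharZero F]
  [ValuativeRel F] [TopologicalSpace F] [IsNonarchimedeanLocalField F] [TopologicalSpace L]
  {a b : 𝒪[F]} {c : 𝒪[F]ˣ} {δ : L} {Ω : Lˣ →ₜ* ℂˣ}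

theorem IsIntegralTheta.apply_eq_one [IsModuleTopology F L] (h : IsIntegralTheta (b : F) δ)
    (hδ : δ ^ 2 = algebraMap F L ((b : F) ^ 2 - 4 * a * (c : 𝒪[F]))) {π : 𝒪[F]}
    (hπ : Irreducible π) {m : ℕ} (hm : conductorExp F Ω ≤ m) {x y : 𝒪[F]} (hx : π ^ m ∣ x - 1)
    (hy : π ^ m ∣ y) (hN : IsUnit (normForm a b c x y)) {z : Lˣ}
    (hz : (z : L) = thetaComb (b : F) δ x y) : Ω z = 1 := by
  let v : integersOf F L := ⟨_, thetaComb_mem_integersOf hδ x y⟩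
  obtain ⟨u, hu⟩ := (h.isUnit_iff hδ (u := v) rfl).mpr hN
  -- `sInf` of an empty set of naturals is 0, so nonemptiness is needed for c(Ω) to be an attained
  -- minimum.
  have hmem := Nat.sInf_mem (h.exists_trivial hδ Ω) u ?_
  · convert hmem
    apply Units.ext
    rw [hz]
    change (v : L) = (u : integersOf F L)
    rw [hu]
  · apply Ideal.pow_le_pow_right hm
    rw [hu]
    refine (h.mem_primeExt_pow hδ hπ (x := x - 1) (y := y) ?_).mpr ⟨hx, hy⟩
    change thetaComb (b : F) δ x y - 1 = _
    rw [← thetaComb_one (b : F) δ, thetaComb_sub, sub_zero]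
    rfl

/-- By minimality of c(Ω) there is a unit u in 1 + 𝔓_L^m with Ω(u) ≠ 1, and `apply_diagOne_of_unit`
gives B = Ω(u)B at this point. -/
theorem IsIntegralTheta.apply_diagOne_eq_zero (h : IsIntegralTheta (b : F) δ)
    (hδ : δ ^ 2 = algebraMap F L ((b : F) ^ 2 - 4 * a * (c : 𝒪[F]))) {π : 𝒪[F]}
    (hπ : Irreducible π) {ϖ : Fˣ} (hπϖ : (π : F) = ϖ) {B : GL (Fin 2) F → ℂ}
    (hB : B ∈ waldspurgerSpace (a : F) b (c : 𝒪[F]) δ Ω) (hs : IsSpherical B)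
    {m : ℕ} (hm : m < conductorExp F Ω) : B (diagOne (ϖ ^ m)) = 0 := by
  have hnot := Nat.notMem_of_lt_sInf hm
  simp only [Set.mem_ofPred_eq, not_forall] at hnot
  obtain ⟨u, hu, hΩ⟩ := hnot
  obtain ⟨x, y, hxy⟩ := h.exists_eq u
  have hxy1 : (((u : integersOf F L) - 1 : integersOf F L) : L) =
      thetaComb (b : F) δ (x - 1 : 𝒪[F]) y := by
    rw [Subalgebra.coe_sub, hxy, Subalgebra.coe_one, ← thetaComb_one (b : F) δ, thetaComb_sub,
      sub_zero]
    rfl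
  obtain ⟨-, y', rfl⟩ := (h.mem_primeExt_pow hδ hπ hxy1).mp hu
  have hN := (h.isUnit_iff hδ hxy).mp u.isUnit
  have h1 := apply_diagOne_of_unit hB hs hπϖ m x y' hN
    (z := Units.map (algebraMap (integersOf F L) L).toMonoidHom u) hxy
  by_contra hne
  apply hΩ
  apply Units.ext
  exact (mul_eq_right₀ hne).mp h1.symm

end Conductor

/-! ### Arithmetic of 𝔬_L in the unramified, ramified and split cases. -/

section Cases

variable {F : Type*} [Field F] {L : Type*} [CommRing L] [Algebra F L] [CharZero F]
  [ValuativeRel F] [TopologicalSpace F] [IsNonarchimedeanLocalField F]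
  {a b : 𝒪[F]} {c : 𝒪[F]} {δ : L}

/-- The norm is the product of x + yθ and its conjugate. If 𝔓_L is prime and contains it, it
contains a factor, and then π divides both coordinates. -/
theorem IsIntegralTheta.not_dvd_normForm_of_isMaximal (h : IsIntegralTheta (b : F) δ)
    (hδ : δ ^ 2 = algebraMap F L ((b : F) ^ 2 - 4 * a * c)) {π : 𝒪[F]} (hπ : Irreducible π)
    (hmax : (primeExt F L).IsMaximal) {x y : 𝒪[F]} (hxy : IsUnit x ∨ IsUnit y) :
    ¬ π ∣ normForm a b c x y := by
  intro hN
  have hprim : ¬ (π ∣ x ∧ π ∣ y) := by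
    rintro ⟨h1, h2⟩
    rcases hxy with hx | hx
    · exact hπ.not_isUnit (isUnit_of_dvd_unit h1 hx)
    · exact hπ.not_isUnit (isUnit_of_dvd_unit h2 hx)
  have hmem : ∀ {u : integersOf F L} {x y : 𝒪[F]}, (u : L) = thetaComb (b : F) δ x y →
      (u ∈ primeExt F L ↔ π ∣ x ∧ π ∣ y) := by
    intro u x y hu
    have := h.mem_primeExt_pow hδ hπ (m := 1) hu
    simpa using this
  let v : integersOf F L := ⟨_, thetaComb_mem_integersOf hδ x y⟩
  let w : integersOf F L := ⟨_, thetaComb_mem_integersOf hδ (x + y * b) (-y)⟩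
  have hvw : v * w ∈ primeExt F L := by
    refine (hmem (x := normForm a b c x y) (y := 0) ?_).mpr ⟨hN, dvd_zero _⟩
    have h1 := thetaComb_mul_conj hδ (x : F) y
    rw [normForm_coe, ← thetaComb_zero (b : F) δ] at h1
    change thetaComb (b : F) δ x y * thetaComb (b : F) δ (x + y * b : 𝒪[F]) (-y : 𝒪[F]) = _
    push_cast
    exact h1
  rcases hmax.isPrime.mem_or_mem hvw with h1 | h1
  · exact hprim ((hmem rfl).mp h1)
  · obtain ⟨h2, h3⟩ := (hmem (u := w) rfl).mp h1
    rw [dvd_neg] at h3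
    exact hprim ⟨(dvd_add_left (h3.mul_right b)).mp h2, h3⟩

/-- Take an element of a maximal ideal strictly larger than 𝔓_L, lying outside 𝔓_L: it is primitive
but not a unit. -/
theorem IsIntegralTheta.exists_dvd_normForm_of_not_isMaximal (h : IsIntegralTheta (b : F) δ)
    (hδ : δ ^ 2 = algebraMap F L ((b : F) ^ 2 - 4 * a * c)) {π : 𝒪[F]} (hπ : Irreducible π)
    (hmax : ¬ (primeExt F L).IsMaximal) :
    ∃ x y : 𝒪[F], (IsUnit x ∨ IsUnit y) ∧ π ∣ normForm a b c x y := by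
  have hmem : ∀ {u : integersOf F L} {x y : 𝒪[F]}, (u : L) = thetaComb (b : F) δ x y →
      (u ∈ primeExt F L ↔ π ∣ x ∧ π ∣ y) := by
    intro u x y hu
    have := h.mem_primeExt_pow hδ hπ (m := 1) hu
    simpa using this
  have hne : primeExt F L ≠ ⊤ := by
    intro htop
    have h1 : (1 : integersOf F L) ∈ primeExt F L := by rw [htop]; trivial
    have h2 := (hmem (x := 1) (y := 0) (by simp [thetaComb_one])).mp h1
    exact hπ.not_isUnit (isUnit_of_dvd_one h2.1)
  obtain ⟨M, hM, hle⟩ := Ideal.exists_le_maximal _ hne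
  obtain ⟨v, hvM, hvP⟩ := Set.exists_of_ssubset
    (lt_of_le_of_ne hle (by rintro rfl; exact hmax hM) : primeExt F L < M)
  obtain ⟨x, y, hxy⟩ := h.exists_eq v
  refine ⟨x, y, ?_, ?_⟩
  · by_contra! hcon
    exact hvP ((hmem hxy).mpr ⟨(isUnit_or_dvd hπ x).resolve_left hcon.1,
      (isUnit_or_dvd hπ y).resolve_left hcon.2⟩)
  · refine (isUnit_or_dvd hπ _).resolve_left fun hu => hM.ne_top ?_
    exact Ideal.eq_top_of_isUnit_mem _ hvM ((h.isUnit_iff hδ hxy).mpr hu)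

omit [CharZero F] in
-- If d were a unit, t = x/y would be a simple root of X² + bX + ac modulo 𝔭. Hensel lifts it to a
-- root r, and then d = (2r + b)² is a square.
theorem dvd_disc_of_dvd_normForm (hsq : ¬ IsSquare ((b : F) ^ 2 - 4 * a * c)) {π : 𝒪[F]}
    (hπ : Irreducible π) {x y : 𝒪[F]} (hxy : IsUnit x ∨ IsUnit y) (hN : π ∣ normForm a b c x y) :
    π ∣ b ^ 2 - 4 * a * c := by
  by_contra hd
  have hdu := (isUnit_or_dvd hπ _).resolve_right hd
  have hy : IsUnit y := by
    refine (isUnit_or_dvd hπ y).resolve_right fun hy => ?_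
    have hx : π ∣ x ^ 2 := by
      have h1 : normForm a b c x y = x ^ 2 + y * (b * x + a * c * y) := by rw [normForm]; ring
      rw [h1] at hN
      exact (dvd_add_left (hy.mul_right _)).mp hN
    rcases hxy with h | h
    · exact hπ.not_isUnit (isUnit_of_dvd_unit hx (h.pow 2))
    · exact hπ.not_isUnit (isUnit_of_dvd_unit hy h)
  obtain ⟨y, rfl⟩ := hy
  have hyy : (y : 𝒪[F]) * (y⁻¹ : 𝒪[F]ˣ) = 1 := y.mul_inv
  have hmem : ∀ t : 𝒪[F], t ∈ 𝓂[F] ↔ π ∣ t := by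
    intro t
    rw [hπ.maximalIdeal_eq, Ideal.mem_span_singleton]
  let f : Polynomial 𝒪[F] := Polynomial.X ^ 2 + Polynomial.C b * Polynomial.X + Polynomial.C (a * c)
  let t : 𝒪[F] := x * (y⁻¹ : 𝒪[F]ˣ)
  have hft : π ∣ t ^ 2 + b * t + a * c := by
    have h1 : t ^ 2 + b * t + a * c = normForm a b c x y * ((y⁻¹ : 𝒪[F]ˣ) : 𝒪[F]) ^ 2 := by
      simp only [t, normForm]
      linear_combination (-(b * x * (y⁻¹ : 𝒪[F]ˣ)) -
        a * c * (y * (y⁻¹ : 𝒪[F]ˣ) + 1)) * hyy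
    rw [h1]
    exact hN.mul_right _
  have : HenselianRing 𝒪[F] 𝓂[F] := by
    let := IsTopologicalAddGroup.rightUniformSpace F
    have := isUniformAddGroup_of_addCommGroup (G := F)
    infer_instance
  obtain ⟨r, hr, -⟩ := HenselianRing.is_henselian (I := 𝓂[F]) f (by simp only [f]; monicity!) t
    (by rw [hmem]; simpa [f] using hft) (by
      have h2 : IsUnit (2 * t + b) := by
        refine (isUnit_or_dvd hπ _).resolve_right fun h => hd ?_
        have h3 : b ^ 2 - 4 * a * c = (2 * t + b) * (2 * t + b) - 4 * (t ^ 2 + b * t + a * c) := by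
          ring
        rw [h3]
        exact dvd_sub (h.mul_right _) (hft.mul_left _)
      have h3 : Polynomial.eval t (Polynomial.derivative f) = 2 * t + b := by
        simp [f, one_add_one_eq_two]
      rw [h3]
      exact h2.map _)
  have hr' : r ^ 2 + b * r + a * c = 0 := by simpa [f, Polynomial.IsRoot] using hr
  apply hsq
  refine ⟨2 * r + b, ?_⟩
  have h4 : (r : F) ^ 2 + b * r + a * c = 0 := by exact_mod_cast congrArg Subtype.val hr'
  linear_combination (-4) * h4

/-- Since Tr² = y²d + 4N, the assumption π² ∣ N together with π ∣ d gives π ∣ Tr. Then (x + yθ)/π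
satisfies a monic equation over 𝔬, so π divides both x and y. -/
theorem IsIntegralTheta.not_sq_dvd_normForm (h : IsIntegralTheta (b : F) δ)
    (hδ : δ ^ 2 = algebraMap F L ((b : F) ^ 2 - 4 * a * c)) {π : 𝒪[F]} (hπ : Irreducible π)
    (hd : π ∣ b ^ 2 - 4 * a * c) {x y : 𝒪[F]} (hxy : IsUnit x ∨ IsUnit y) :
    ¬ π ^ 2 ∣ normForm a b c x y := by
  rintro ⟨n, hn⟩
  have hπ0 : (π : F) ≠ 0 := by simpa using hπ.ne_zero
  have hT : π ∣ 2 * x + y * b := by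
    apply hπ.prime.dvd_of_dvd_pow (n := 2)
    have h1 : (2 * x + y * b) ^ 2 = y ^ 2 * (b ^ 2 - 4 * a * c) + 4 * normForm a b c x y := by
      rw [normForm]; ring
    rw [h1, hn]
    exact dvd_add (hd.mul_left _) (Dvd.intro _ (by ring : π * (π * n * 4) = _))
  obtain ⟨t, ht⟩ := hT
  have ht' : 2 * (x : F) + y * b = π * t := by
    have := congrArg (algebraMap 𝒪[F] F) ht
    simp only [map_add, map_mul, map_ofNat] at this
    exact this
  have hn' : (x : F) ^ 2 + b * x * y + a * c * y ^ 2 = π ^ 2 * n := by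
    exact_mod_cast congrArg Subtype.val hn
  have hint : thetaComb (b : F) δ (x / π) (y / π) ∈ integersOf F L := by
    refine ⟨Polynomial.X ^ 2 - Polynomial.C t * Polynomial.X + Polynomial.C n, by monicity!, ?_⟩
    have h2 : ∀ t : 𝒪[F], algebraMap 𝒪[F] L t = algebraMap F L t := fun t => rfl
    simp only [Polynomial.eval₂_add, Polynomial.eval₂_sub, Polynomial.eval₂_pow,
      Polynomial.eval₂_mul, Polynomial.eval₂_X, Polynomial.eval₂_C, h2]
    rw [sq, thetaComb_mul hδ, algebraMap_mul_thetaComb, thetaComb_sub, ← thetaComb_zero (b : F) δ,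
      thetaComb_add]
    have h3 : (t : F) = (2 * x + y * b) / π := by rw [ht']; field_simp
    have h4 : (n : F) = (x ^ 2 + b * x * y + a * c * y ^ 2) / π ^ 2 := by rw [hn']; field_simp
    have h5 : thetaComb (b : F) δ 0 0 = 0 := by rw [thetaComb_zero, map_zero]
    rw [← h5]
    congr 1
    · rw [h3, h4]; field_simp; ring
    · rw [h3]; field_simp; ring
  obtain ⟨h1, h2⟩ := h.integral _ _ hint
  have hdvd : ∀ s : 𝒪[F], (s : F) / π ∈ 𝒪[F] → π ∣ s := by
    intro s hs
    refine ⟨⟨_, hs⟩, Subtype.ext ?_⟩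
    rw [Subring.coe_mul]
    field_simp
  rcases hxy with hx | hx
  · exact hπ.not_isUnit (isUnit_of_dvd_unit (hdvd x h1) hx)
  · exact hπ.not_isUnit (isUnit_of_dvd_unit (hdvd y h2) hx)

/-- Makes Ω(ϖ_L) independent of the uniformizer when Ω is trivial on units. Irreducibility rules out
both coordinates being divisible by π, as π itself is a unit times (p + rθ) and its conjugate;
otherwise p + rθ divides w, and the quotient has unit norm because π² does not divide N(w). -/
theorem IsIntegralTheta.exists_eq_mul_of_isUniformizer (h : IsIntegralTheta (b : F) δ)
    (hδ : δ ^ 2 = algebraMap F L ((b : F) ^ 2 - 4 * a * c)) {π : 𝒪[F]} (hπ : Irreducible π)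
    {p r : 𝒪[F]} {e : 𝒪[F]ˣ} (he : normForm a b c p r = π * e)
    (hbad : ∀ x y : 𝒪[F], IsUnit x ∨ IsUnit y → π ∣ normForm a b c x y →
      ConjDvd π a b c p r x y ∧ ¬ π ^ 2 ∣ normForm a b c x y)
    {w : Lˣ} (hw : IsUniformizer (integersOf F L) w) :
    ∃ s t : 𝒪[F], IsUnit (normForm a b c s t) ∧
      (w : L) = thetaComb (b : F) δ s t * thetaComb (b : F) δ p r := by
  obtain ⟨u, hu, huw⟩ := hw
  obtain ⟨x, y, hxy⟩ := h.exists_eq u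
  have hee : (e : 𝒪[F]) * (e⁻¹ : 𝒪[F]ˣ) = 1 := e.mul_inv
  have hwu : (w : L) = u := huw.symm
  have hnu : ∀ {z : 𝒪[F]}, π ∣ z → ¬ IsUnit z :=
    fun hz hz' => hπ.not_isUnit (isUnit_of_dvd_unit hz hz')
  have hprim : IsUnit x ∨ IsUnit y := by
    by_contra! hcon
    obtain ⟨x', rfl⟩ := (isUnit_or_dvd hπ x).resolve_left hcon.1
    obtain ⟨y', rfl⟩ := (isUnit_or_dvd hπ y).resolve_left hcon.2
    let A : integersOf F L := ⟨_, thetaComb_mem_integersOf hδ p r⟩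
    let A' : integersOf F L := ⟨_, thetaComb_mem_integersOf hδ (p + r * b) (-r)⟩
    let C : integersOf F L :=
      ⟨_, thetaComb_mem_integersOf hδ ((e⁻¹ : 𝒪[F]ˣ) * x') ((e⁻¹ : 𝒪[F]ˣ) * y')⟩
    have hA : ¬ IsUnit A := by
      rw [h.isUnit_iff hδ (u := A) rfl, he]
      exact hnu (dvd_mul_right _ _)
    have hA' : ¬ IsUnit A' := by
      rw [h.isUnit_iff hδ (u := A') rfl]
      have h1 : normForm a b c (p + r * b) (-r) = π * e := by
        rw [← he]; simp only [normForm]; ring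
      rw [h1]
      exact hnu (dvd_mul_right _ _)
    have huA : u = A * (A' * C) := by
      apply Subtype.ext
      rw [hxy, Subalgebra.coe_mul, Subalgebra.coe_mul, ← mul_assoc]
      have h1 := thetaComb_mul_conj hδ (p : F) r
      rw [normForm_coe, he] at h1
      have h2 : (A : L) * A' = algebraMap F L (π * e : 𝒪[F]) := by
        rw [← h1]
        change _ * thetaComb (b : F) δ (p + r * b : 𝒪[F]) (-r : 𝒪[F]) = _
        push_cast
        rfl
      rw [h2, algebraMap_mul_thetaComb, ← Subring.coe_mul, ← Subring.coe_mul,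
        show π * e * ((e⁻¹ : 𝒪[F]ˣ) * x') = π * x' by linear_combination π * x' * hee,
        show π * e * ((e⁻¹ : 𝒪[F]ˣ) * y') = π * y' by linear_combination π * y' * hee]
    rcases hu.isUnit_or_isUnit huA with h1 | h1
    · exact hA h1
    · exact hA' (isUnit_of_mul_isUnit_left h1)
  have hN : π ∣ normForm a b c x y := (isUnit_or_dvd hπ _).resolve_left fun h1 =>
    hu.not_isUnit ((h.isUnit_iff hδ hxy).mpr h1)
  obtain ⟨⟨⟨s, hs⟩, ⟨t, ht⟩⟩, hsq⟩ := hbad x y hprim hN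
  set s' := s * ((e⁻¹ : 𝒪[F]ˣ) : 𝒪[F])
  set t' := t * ((e⁻¹ : 𝒪[F]ˣ) : 𝒪[F])
  have hx : s' * p - t' * r * (a * c) = x := by
    apply mul_left_cancel₀ hπ.ne_zero
    unfold normForm at he
    linear_combination ((e⁻¹ : 𝒪[F]ˣ) : 𝒪[F]) * (-p * hs + r * (a * c) * ht + x * he) + π * x * hee
  have hy : s' * r + t' * p + t' * r * b = y := by
    apply mul_left_cancel₀ hπ.ne_zero
    unfold normForm at he
    linear_combination ((e⁻¹ : 𝒪[F]ˣ) : 𝒪[F]) * (-r * hs - (p + r * b) * ht + y * he) + π * y * hee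
  refine ⟨s', t', (isUnit_or_dvd hπ _).resolve_right fun hdvd => hsq ?_, ?_⟩
  · rw [← hx, ← hy, normForm_mul, he, ← mul_assoc, sq]
    exact (mul_dvd_mul_right hdvd π).mul_right _
  · rw [hwu, hxy, thetaComb_mul hδ, ← hx, ← hy]
    push_cast
    rfl

omit [TopologicalSpace F] [IsNonarchimedeanLocalField F] in
-- The roots θ₁, θ₂ are the two components of e(θ). They differ because e is onto, and (θ₁ - θ₂)² =
-- d is a unit.
theorem exists_roots_of_algEquiv (hd : IsUnit (b ^ 2 - 4 * a * c))
    (h : IsIntegralTheta (b : F) δ) (hδ : δ ^ 2 = algebraMap F L ((b : F) ^ 2 - 4 * a * c))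
    (e : L ≃ₐ[F] F × F) :
    ∃ θ₁ θ₂ : 𝒪[F], IsUnit (θ₁ - θ₂) ∧ θ₁ + θ₂ = b ∧ θ₁ * θ₂ = a * c ∧
      ∀ x y : F, e (thetaComb (b : F) δ x y) = (x + y * θ₁, x + y * θ₂) := by
  have h1 : (e (thetaComb (b : F) δ 0 1)).1 ∈ 𝒪[F] := mem_integer_of_isIntegral
    (IsIntegral.map (((AlgHom.fst F F F).comp e.toAlgHom).restrictScalars 𝒪[F]) (isIntegral_theta hδ))
  have h2 : (e (thetaComb (b : F) δ 0 1)).2 ∈ 𝒪[F] := mem_integer_of_isIntegral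
    (IsIntegral.map (((AlgHom.snd F F F).comp e.toAlgHom).restrictScalars 𝒪[F]) (isIntegral_theta hδ))
  obtain ⟨θ₁, hθ₁⟩ : ∃ θ₁ : 𝒪[F], (θ₁ : F) = (e (thetaComb (b : F) δ 0 1)).1 := ⟨⟨_, h1⟩, rfl⟩
  obtain ⟨θ₂, hθ₂⟩ : ∃ θ₂ : 𝒪[F], (θ₂ : F) = (e (thetaComb (b : F) δ 0 1)).2 := ⟨⟨_, h2⟩, rfl⟩
  have he : ∀ x y : F, e (thetaComb (b : F) δ x y) = (x + y * θ₁, x + y * θ₂) := by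
    intro x y
    have h3 : thetaComb (b : F) δ x y =
        algebraMap F L x + algebraMap F L y * thetaComb (b : F) δ 0 1 := by
      simp [thetaComb]
    rw [h3, map_add, map_mul, AlgEquiv.commutes, AlgEquiv.commutes, hθ₁, hθ₂]
    rfl
  have hsq := congrArg e (thetaComb_mul hδ 0 1 0 1)
  rw [map_mul, he, he] at hsq
  have e1 := congrArg Prod.fst hsq
  have e2 := congrArg Prod.snd hsq
  simp at e1 e2
  have hne : (θ₁ : F) - θ₂ ≠ 0 := by
    intro h0
    obtain ⟨z, hz⟩ := e.surjective (1, 0)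
    obtain ⟨x, y, rfl⟩ := h.surj z
    rw [he, Prod.mk.injEq, ← sub_eq_zero.mp h0] at hz
    exact one_ne_zero (hz.1.symm.trans hz.2)
  have hsum : (θ₁ : F) + θ₂ = b := by
    apply mul_left_cancel₀ hne
    linear_combination e1 - e2
  have hprod : (θ₁ : F) * θ₂ = a * c := by
    linear_combination θ₁ * hsum - e1
  have hsum' : θ₁ + θ₂ = b := Subtype.ext hsum
  have hprod' : θ₁ * θ₂ = a * c := Subtype.ext hprod
  refine ⟨θ₁, θ₂, ?_, hsum', hprod', he⟩
  apply isUnit_of_mul_isUnit_left (y := θ₁ - θ₂)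
  convert hd using 1
  rw [← hsum', mul_assoc 4, ← hprod']
  ring

omit [CharZero F] [ValuativeRel F] [TopologicalSpace F] [IsNonarchimedeanLocalField F] in
theorem coe_splitUnit (e : L ≃ₐ[F] F × F) (x y : Fˣ) :
    (splitUnit e x y : L) = e.symm ((x : F), (y : F)) := rfl

omit [ValuativeRel F] [TopologicalSpace F] [IsNonarchimedeanLocalField F] in
-- An automorphism of F ⊕ F is determined by the image of the idempotent (1, 0), which is (1, 0) or
-- (0, 1). Thus the symmetric expression for κ in the split case does not depend on e.
theorem splitUnit_eq_or_swap (e e' : L ≃ₐ[F] F × F) :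
    (∀ x y, splitUnit e x y = splitUnit e' x y) ∨ (∀ x y, splitUnit e x y = splitUnit e' y x) := by
  have hdec : ∀ x y : F, e' (e.symm (x, y)) =
      (y, y) + algebraMap F (F × F) (x - y) * e' (e.symm (1, 0)) := by
    intro x y
    have : ((x, y) : F × F) =
        algebraMap F (F × F) y + algebraMap F (F × F) (x - y) * (1, 0) := by
      ext <;> simp
    rw [this]
    simp only [map_add, map_mul, AlgEquiv.commutes]
    rfl
  have hidem : e' (e.symm (1, 0)) * e' (e.symm (1, 0)) = e' (e.symm (1, 0)) := by
    rw [← map_mul, ← map_mul]; simp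
  have h0 : e' (e.symm (1, 0)) ≠ 0 := by
    rw [Ne, map_eq_zero_iff e' e'.injective, map_eq_zero_iff e.symm e.symm.injective]
    simp
  have h1 : e' (e.symm (1, 0)) ≠ 1 := by
    rw [Ne, map_eq_one_iff e' e'.injective, map_eq_one_iff e.symm e.symm.injective]
    simp
  generalize e' (e.symm (1, 0)) = ε at *
  obtain ⟨u, v⟩ := ε
  rw [Prod.mk_mul_mk, Prod.mk.injEq] at hidem
  have hu := IsIdempotentElem.iff_eq_zero_or_one.mp hidem.1
  have hv := IsIdempotentElem.iff_eq_zero_or_one.mp hidem.2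
  have key : ((u = 1 ∧ v = 0) ∨ (u = 0 ∧ v = 1)) := by
    rcases hu with rfl | rfl <;> rcases hv with rfl | rfl <;> simp at h0 h1 ⊢
  rcases key with ⟨rfl, rfl⟩ | ⟨rfl, rfl⟩
  · left
    intro x y
    apply Units.ext
    apply e'.injective
    rw [coe_splitUnit, coe_splitUnit, hdec]
    simp
  · right
    intro x y
    apply Units.ext
    apply e'.injective
    rw [coe_splitUnit, coe_splitUnit, hdec]
    simp

end Cases

/-! ### From the recursion to the generating series. -/

section PowerSeries

open PowerSeries

theorem powerSeries_eq_of_recursion (β : ℕ → ℂ) (n : ℕ) {q ω lam κ : ℂ} (hq : q ≠ 0)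
    (h0 : q * β (n + 1) - lam * β n = -(κ * β n))
    (hrec : ∀ m, n ≤ m → lam * β (m + 1) = q * β (m + 2) + ω * β m) :
    PowerSeries.mk (fun m : ℕ => if n ≤ m then β m else 0) =
      (C q - C κ * X) * X ^ n * (C ω * X ^ 2 - C lam * X + C q)⁻¹ * C (β n) := by
  have hmk : PowerSeries.mk (fun m : ℕ => if n ≤ m then β m else 0) =
      X ^ n * PowerSeries.mk (fun m => β (m + n)) := by
    ext m
    rw [coeff_X_pow_mul', coeff_mk]
    split_ifs with h
    · rw [coeff_mk, Nat.sub_add_cancel h]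
    · rfl
  have hden : PowerSeries.mk (fun m => β (m + n)) * (C ω * X ^ 2 - C lam * X + C q) =
      (C q - C κ * X) * C (β n) := by
    set G := PowerSeries.mk (fun m => β (m + n)) with hG
    have h1 : G * (C ω * X ^ 2 - C lam * X + C q) =
        C ω * (G * X ^ 2) - C lam * (G * X) + C q * G := by ring
    have h2 : (C q - C κ * X) * C (β n) = C (q * β n) - C (κ * β n) * X := by
      simp only [map_mul]; ring
    rw [h1, h2]
    ext m
    match m with
    | 0 => simp [hG]
    | 1 =>
      have hX : coeff 1 (G * X) = coeff 0 G := coeff_succ_mul_X 0 G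
      simp only [map_add, map_sub, coeff_C_mul, coeff_mul_X_pow', hX]
      simp [hG]
      rw [add_comm 1 n]
      linear_combination h0
    | m + 2 =>
      simp only [map_add, map_sub, coeff_C_mul]
      rw [coeff_mul_X_pow, show m + 2 = (m + 1) + 1 from rfl, coeff_succ_mul_X, coeff_C, coeff_X]
      have := hrec (m + n) (by omega)
      simp [hG]
      rw [show m + 1 + n = m + n + 1 by ring, show m + 1 + 1 + n = m + n + 2 by ring]
      linear_combination -this
  have hc : constantCoeff (C ω * X ^ 2 - C lam * X + C q : PowerSeries ℂ) ≠ 0 := by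
    simpa using hq
  rw [hmk, show (C q - C κ * X) * X ^ n * (C ω * X ^ 2 - C lam * X + C q)⁻¹ * C (β n) =
    (X ^ n * ((C q - C κ * X) * C (β n))) * (C ω * X ^ 2 - C lam * X + C q)⁻¹ by ring,
    eq_mul_inv_iff_mul_eq hc, ← hden]
  ring

end PowerSeries

/-! ### The initial Hecke relation in the three cases. -/

section Main

variable {F : Type*} [Field F] [CharZero F] [ValuativeRel F] [TopologicalSpace F]
  [IsNonarchimedeanLocalField F] {L : Type*} [CommRing L] [Algebra F L] [TopologicalSpace L]
  {a b : 𝒪[F]} {c : 𝒪[F]ˣ} {δ : L} {Ω : Lˣ →ₜ* ℂˣ} {B : GL (Fin 2) F → ℂ}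

/-- The first Hecke relation when `L/F` is unramified and `Ω` is unramified. -/
theorem hecke_zero_of_isMaximal (hB : B ∈ waldspurgerSpace (a : F) b (c : 𝒪[F]) δ Ω)
    (hs : IsSpherical B) (hδ : δ ^ 2 = algebraMap F L ((b : F) ^ 2 - 4 * a * (c : 𝒪[F])))
    (h : IsIntegralTheta (b : F) δ) {ϖ : Fˣ} {π : 𝒪[F]} (hπ : Irreducible π) (hπϖ : (π : F) = ϖ)
    [Fintype 𝓀[F]] (σ : 𝓀[F] → 𝒪[F]) (hσ : ∀ x, IsLocalRing.residue 𝒪[F] (σ x) = x) {lam : ℂ}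
    (hlam : ∀ g, ∑ x, B (g * upperTri ϖ 1 (σ x)) + B (g * upperTri 1 ϖ 0) = lam * B g)
    (htriv : ∀ (x y : 𝒪[F]) (z : Lˣ), IsUnit (normForm a b c x y) →
      (z : L) = thetaComb (b : F) δ x y → Ω z = 1) (hmax : (primeExt F L).IsMaximal) :
    lam * B 1 = (residueCard F + 1) * B (diagOne ϖ) := by
  have := hecke_recursion_zero hB hs hδ hπ hπϖ σ hσ hlam htriv (ι := Empty) Empty.elim Empty.elim
    Empty.elim (fun i => i.elim) Empty.elim (fun i => i.elim)
    (fun x y hxy hN => absurd hN (h.not_dvd_normForm_of_isMaximal hδ hπ hmax hxy))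
  simpa using this

/-- The first Hecke relation when `L/F` is ramified and `Ω` is unramified. -/
theorem hecke_zero_of_not_isMaximal (hB : B ∈ waldspurgerSpace (a : F) b (c : 𝒪[F]) δ Ω)
    (hs : IsSpherical B) (hδ : δ ^ 2 = algebraMap F L ((b : F) ^ 2 - 4 * a * (c : 𝒪[F])))
    (h : IsIntegralTheta (b : F) δ) {ϖ : Fˣ} {π : 𝒪[F]} (hπ : Irreducible π) (hπϖ : (π : F) = ϖ)
    [Fintype 𝓀[F]] (σ : 𝓀[F] → 𝒪[F]) (hσ : ∀ x, IsLocalRing.residue 𝒪[F] (σ x) = x) {lam : ℂ}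
    (hlam : ∀ g, ∑ x, B (g * upperTri ϖ 1 (σ x)) + B (g * upperTri 1 ϖ 0) = lam * B g)
    (htriv : ∀ (x y : 𝒪[F]) (z : Lˣ), IsUnit (normForm a b c x y) →
      (z : L) = thetaComb (b : F) δ x y → Ω z = 1) (hmax : ¬ (primeExt F L).IsMaximal)
    (hsq : ¬ IsSquare ((b : F) ^ 2 - 4 * a * (c : 𝒪[F]))) :
    ∃ κ : ℂ, (∀ ϖL : Lˣ, IsUniformizer (integersOf F L) ϖL → κ = Ω ϖL) ∧
      lam * B 1 = residueCard F * B (diagOne ϖ) + κ * B 1 := by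
  obtain ⟨p, r, hpr, hN⟩ := h.exists_dvd_normForm_of_not_isMaximal hδ hπ hmax
  have hd := dvd_disc_of_dvd_normForm hsq hπ hpr hN
  have hunit : ∀ n : 𝒪[F], ¬ π ^ 2 ∣ π * n → IsUnit n := by
    intro n hn
    refine (isUnit_or_dvd hπ n).resolve_right fun h' => hn ?_
    rw [sq]
    exact mul_dvd_mul_left π h'
  obtain ⟨n, hn⟩ := hN
  obtain ⟨e, rfl⟩ := hunit n (hn ▸ h.not_sq_dvd_normForm hδ hπ hd hpr)
  -- If p + rθ did not divide x + yθ, then (x + yθ) times the conjugate of p + rθ would be primitive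
  -- with norm divisible by π², contradicting `IsIntegralTheta.not_sq_dvd_normForm`.
  have hbad : ∀ x y : 𝒪[F], IsUnit x ∨ IsUnit y → π ∣ normForm a b c x y →
      ConjDvd π a b c p r x y ∧ ¬ π ^ 2 ∣ normForm a b (c : 𝒪[F]) x y := by
    intro x y hxy hN
    refine ⟨?_, h.not_sq_dvd_normForm hδ hπ hd hxy⟩
    by_contra hcon
    have hprim : IsUnit (x * (p + r * b) + y * r * (a * c)) ∨ IsUnit (y * p - x * r) := by
      by_contra! h'
      exact hcon ⟨(isUnit_or_dvd hπ _).resolve_left h'.1, (isUnit_or_dvd hπ _).resolve_left h'.2⟩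
    apply h.not_sq_dvd_normForm hδ hπ hd hprim
    have h1 : normForm a b c (x * (p + r * b) + y * r * (a * c)) (y * p - x * r) =
        normForm a b c x y * normForm a b c p r := by
      simp only [normForm]; ring
    rw [h1, hn, sq]
    exact mul_dvd_mul hN (dvd_mul_right _ _)
  obtain ⟨w, hw⟩ := exists_unit_eq_thetaComb_coe hδ (x := p) (y := r)
    (by rw [hn]; exact mul_ne_zero hπ.ne_zero e.ne_zero)
  refine ⟨Ω w, ?_, ?_⟩
  · intro ϖL hϖL
    obtain ⟨s, t, hst, heq⟩ := h.exists_eq_mul_of_isUniformizer hδ hπ hn hbad hϖL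
    obtain ⟨z, hz⟩ := exists_unit_eq_thetaComb_coe hδ hst.ne_zero
    have h1 : ϖL = z * w := by
      apply Units.ext
      rw [heq, Units.val_mul, hz, hw]
    rw [h1, map_mul, htriv s t z hst hz, one_mul]
  · have := hecke_recursion_zero hB hs hδ hπ hπϖ σ hσ hlam htriv (ι := Unit) (fun _ => p)
      (fun _ => r) (fun _ => e) (fun _ => hn) (fun _ => w) (fun _ => hw)
      (fun x y hxy hN => ⟨(), (hbad x y hxy hN).1, fun _ _ => rfl⟩)
    simpa using this

/-- The first Hecke relation when `L = F ⊕ F` and `Ω` is unramified. -/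
theorem hecke_zero_of_algEquiv (hB : B ∈ waldspurgerSpace (a : F) b (c : 𝒪[F]) δ Ω)
    (hs : IsSpherical B) (hδ : δ ^ 2 = algebraMap F L ((b : F) ^ 2 - 4 * a * (c : 𝒪[F])))
    (h : IsIntegralTheta (b : F) δ) {ϖ : Fˣ} {π : 𝒪[F]} (hπ : Irreducible π) (hπϖ : (π : F) = ϖ)
    [Fintype 𝓀[F]] (σ : 𝓀[F] → 𝒪[F]) (hσ : ∀ x, IsLocalRing.residue 𝒪[F] (σ x) = x) {lam : ℂ}
    (hlam : ∀ g, ∑ x, B (g * upperTri ϖ 1 (σ x)) + B (g * upperTri 1 ϖ 0) = lam * B g)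
    (htriv : ∀ (x y : 𝒪[F]) (z : Lˣ), IsUnit (normForm a b c x y) →
      (z : L) = thetaComb (b : F) δ x y → Ω z = 1) (hd : IsUnit (b ^ 2 - 4 * a * c))
    (e : L ≃ₐ[F] F × F) :
    lam * B 1 = (residueCard F - 1) * B (diagOne ϖ) +
      ((Ω (splitUnit e ϖ 1) : ℂ) + Ω (splitUnit e 1 ϖ)) * B 1 := by
  obtain ⟨θ₁, θ₂, ⟨D, hD⟩, hsum, hprod, hθ⟩ := exists_roots_of_algEquiv hd h hδ e
  have hDD : (D : 𝒪[F]) * (D⁻¹ : 𝒪[F]ˣ) = 1 := D.mul_inv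
  have hnorm : ∀ x y : 𝒪[F], normForm a b c x y = (x + y * θ₁) * (x + y * θ₂) := by
    intro x y
    rw [normForm, ← hsum, ← hprod]; ring
  -- Solves p + rθ₁ = u, p + rθ₂ = v, so that p + rθ corresponds to (u, v) in F ⊕ F; this is
  -- integral because θ₁ - θ₂ is a unit. The elements of uniformizing norm used below are (π, 1) and
  -- (1, π).
  let r : 𝒪[F] → 𝒪[F] → 𝒪[F] := fun u v => (u - v) * (D⁻¹ : 𝒪[F]ˣ)
  let p : 𝒪[F] → 𝒪[F] → 𝒪[F] := fun u v => u - r u v * θ₁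
  have hpr₁ : ∀ u v, p u v + r u v * θ₁ = u := fun u v => by simp only [p]; ring
  have hpr₂ : ∀ u v, p u v + r u v * θ₂ = v := fun u v => by
    simp only [p, r]
    linear_combination (u - v) * (D⁻¹ : 𝒪[F]ˣ) * hD - (u - v) * hDD
  have hcoord : ∀ u v : 𝒪[F], thetaComb (b : F) δ (p u v) (r u v) = e.symm ((u : F), (v : F)) := by
    intro u v
    rw [← AlgEquiv.symm_apply_apply e (thetaComb (b : F) δ (p u v) (r u v)), hθ]
    congr 2
    · exact congrArg Subtype.val (hpr₁ u v)
    · exact congrArg Subtype.val (hpr₂ u v)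
  have hdvd : ∀ u v x y : 𝒪[F], ConjDvd π a b c (p u v) (r u v) x y ↔
      π ∣ (x + y * θ₁) * v ∧ π ∣ (x + y * θ₂) * u := by
    intro u v x y
    set X := x * (p u v + r u v * b) + y * r u v * (a * c) with hX
    set Y := y * p u v - x * r u v with hY
    have h1 : (x + y * θ₁) * v = X + Y * θ₁ := by
      rw [hX, hY, ← hsum, ← hprod]
      linear_combination (-(x + y * θ₁)) * hpr₂ u v
    have h2 : (x + y * θ₂) * u = X + Y * θ₂ := by
      rw [hX, hY, ← hsum, ← hprod]
      linear_combination (-(x + y * θ₂)) * hpr₁ u v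
    rw [h1, h2]
    constructor
    · rintro ⟨hx, hy⟩
      exact ⟨dvd_add hx (hy.mul_right _), dvd_add hx (hy.mul_right _)⟩
    · rintro ⟨hx, hy⟩
      have h3 : π ∣ Y := by
        refine (D.isUnit.dvd_mul_right).mp ?_
        have := dvd_sub hx hy
        rwa [show X + Y * θ₁ - (X + Y * θ₂) = Y * D by rw [hD]; ring] at this
      exact ⟨(dvd_add_left (h3.mul_right _)).mp hx, h3⟩
  have hπϖ1 : ∀ (x y : Fˣ) (u v : 𝒪[F]), (u : F) = x → (v : F) = y →
      (splitUnit e x y : L) = thetaComb (b : F) δ (p u v) (r u v) := by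
    intro x y u v hu hv
    rw [coe_splitUnit, hcoord, hu, hv]
  have := hecke_recursion_zero hB hs hδ hπ hπϖ σ hσ hlam htriv (ι := Bool)
    (fun i => cond i (p π 1) (p 1 π)) (fun i => cond i (r π 1) (r 1 π)) (fun _ => 1)
    (by rintro (_ | _) <;> simp [hnorm, hpr₁, hpr₂])
    (fun i => cond i (splitUnit e ϖ 1) (splitUnit e 1 ϖ))
    (by
      rintro (_ | _)
      · exact hπϖ1 _ _ _ _ rfl hπϖ
      · exact hπϖ1 _ _ _ _ hπϖ rfl)
    (by
      intro x y hxy hN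
      rw [hnorm] at hN
      have hnot : ¬ (π ∣ x + y * θ₁ ∧ π ∣ x + y * θ₂) := by
        rintro ⟨h1, h2⟩
        have h3 : π ∣ y := by
          refine (D.isUnit.dvd_mul_right).mp ?_
          have := dvd_sub h1 h2
          rwa [show x + y * θ₁ - (x + y * θ₂) = y * D by rw [hD]; ring] at this
        rcases hxy with hu | hu
        · exact hπ.not_isUnit (isUnit_of_dvd_unit ((dvd_add_left (h3.mul_right _)).mp h1) hu)
        · exact hπ.not_isUnit (isUnit_of_dvd_unit h3 hu)
      have ht : ConjDvd π a b c (p π 1) (r π 1) x y ↔ π ∣ x + y * θ₁ := by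
        rw [hdvd, mul_one]
        exact and_iff_left (dvd_mul_left _ _)
      have hf : ConjDvd π a b c (p 1 π) (r 1 π) x y ↔ π ∣ x + y * θ₂ := by
        rw [hdvd, mul_one]
        exact and_iff_right (dvd_mul_left _ _)
      rcases hπ.prime.dvd_or_dvd hN with h1 | h1
      · refine ⟨true, ht.mpr h1, ?_⟩
        rintro (_ | _) h2
        · exact absurd ⟨h1, hf.mp h2⟩ hnot
        · rfl
      · refine ⟨false, hf.mpr h1, ?_⟩
        rintro (_ | _) h2
        · rfl
        · exact absurd ⟨ht.mp h2, h1⟩ hnot)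
  rw [this, Fintype.card_bool, Fintype.sum_bool]
  push_cast
  simp only [cond_true, cond_false]
  ring

end Main

end Waldspurger
open Waldspurger PowerSeries in
theorem proposition3p4
    {F : Type*} [Field F] [CharZero F] [ValuativeRel F] [TopologicalSpace F]
    [IsNonarchimedeanLocalField F]
    (a b c : F) (ha : a ∈ 𝒪[F]) (hb : b ∈ 𝒪[F]) (hc : ∃ u : 𝒪[F]ˣ, ((u : 𝒪[F]) : F) = c)
    (hd : b ^ 2 - 4 * a * c ≠ 0)
    {L : Type*} [CommRing L] [Algebra F L] [TopologicalSpace L] [IsModuleTopology F L]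
    (δ : L) (hL : IsQuadraticAlgebra (b ^ 2 - 4 * a * c) δ)
    (hdisc : ¬ IsSquare (b ^ 2 - 4 * a * c) →
      discriminant F L = Submodule.span 𝒪[F] {b ^ 2 - 4 * a * c})
    (hunit : IsSquare (b ^ 2 - 4 * a * c) → ∃ u : 𝒪[F]ˣ, ((u : 𝒪[F]) : F) = b ^ 2 - 4 * a * c)
    (ϖ : Fˣ) (hϖ : IsUniformizer 𝒪[F] ϖ)
    (χ₁ χ₂ : Fˣ →ₜ* ℂˣ) (hχ₁ : IsUnramifiedChar χ₁) (hχ₂ : IsUnramifiedChar χ₂)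
    (hirr₁ : ¬ ∀ x : Fˣ, (χ₁ x : ℂ) * (χ₂ x : ℂ)⁻¹ = (normalizedAbs F x : ℂ))
    (hirr₂ : ¬ ∀ x : Fˣ, (χ₁ x : ℂ) * (χ₂ x : ℂ)⁻¹ = (normalizedAbs F x : ℂ)⁻¹)
    (Ω : Lˣ →ₜ* ℂˣ)
    (hΩ : ∀ x : Fˣ, Ω (Units.map (algebraMap F L).toMonoidHom x) = χ₁ x * χ₂ x)
    (W : Subrepresentation (rightRegular F)) (hW : IsWaldspurgerModel a b c δ Ω χ₁ χ₂ W)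
    (B₀ : GL (Fin 2) F → ℂ) (hB₀W : B₀ ∈ W) (hB₀ : IsSpherical B₀)
    (q : ℂ) (hq : q = (residueCard F : ℂ))
    (lam : ℂ) (hlam : lam = (Real.sqrt (residueCard F) : ℂ) * ((χ₁ ϖ : ℂ) + (χ₂ ϖ : ℂ))) :
    ∃ κ : ℂ,
      (0 < conductorExp F Ω → κ = 0) ∧
      (conductorExp F Ω = 0 → legendre F L (b ^ 2 - 4 * a * c) = -1 → κ = lam / (q + 1)) ∧
      (conductorExp F Ω = 0 → legendre F L (b ^ 2 - 4 * a * c) = 0 →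
        ∀ ϖL : Lˣ, IsUniformizer (integersOf F L) ϖL → κ = (Ω ϖL : ℂ)) ∧
      (conductorExp F Ω = 0 → legendre F L (b ^ 2 - 4 * a * c) = 1 →
        ∀ e : L ≃ₐ[F] F × F, κ = -(lam / (q - 1)) +
          q / (q - 1) * ((Ω (splitUnit e ϖ 1) : ℂ) + (Ω (splitUnit e 1 ϖ) : ℂ))) ∧
      PowerSeries.mk (fun m : ℕ => if conductorExp F Ω ≤ m then B₀ (diagOne (ϖ ^ m)) else 0) =
        (C q - C κ * X) * X ^ conductorExp F Ω *
          (C ((χ₁ ϖ : ℂ) * (χ₂ ϖ : ℂ)) * X ^ 2 - C lam * X + C q)⁻¹ *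
          C (B₀ (diagOne (ϖ ^ conductorExp F Ω))) := by
  obtain ⟨c, rfl⟩ := hc
  obtain ⟨a, rfl⟩ : ∃ a' : 𝒪[F], (a' : F) = a := ⟨⟨a, ha⟩, rfl⟩
  obtain ⟨b, rfl⟩ : ∃ b' : 𝒪[F], (b' : F) = b := ⟨⟨b, hb⟩, rfl⟩
  have hδ := hL.sq_eq
  have h := hL.isIntegralTheta hd hdisc hunit
  have hB := hW.le hB₀W
  let : Fintype 𝓀[F] := Fintype.ofFinite _
  obtain ⟨σ, hσ⟩ : ∃ σ : 𝓀[F] → 𝒪[F], ∀ x, IsLocalRing.residue 𝒪[F] (σ x) = x :=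
    (IsLocalRing.residue_surjective).hasRightInverse
  have hhecke := hW.hecke hB₀W hB₀ hϖ σ hσ
  rw [← hlam] at hhecke
  obtain ⟨π, hπ, hπϖ⟩ := hϖ
  replace hπϖ : (π : F) = ϖ := hπϖ
  set n := conductorExp F Ω with hn
  set β : ℕ → ℂ := fun m => B₀ (diagOne (ϖ ^ m)) with hβ
  have hq0 : q ≠ 0 := by rw [hq]; exact Nat.cast_ne_zero.mpr residueCard_pos.ne'
  -- The range starts at m = n - 1, not n: when n > 0 this extra instance, together with β(n - 1) =
  -- 0, gives κ = 0.
  have hrec : ∀ m, n ≤ m + 1 →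
      lam * β (m + 1) = q * β (m + 2) + (χ₁ ϖ : ℂ) * (χ₂ ϖ : ℂ) * β m := by
    intro m hm
    have := hecke_recursion hB hB₀ hδ hπ hπϖ σ hhecke m (fun y z hz =>
      h.apply_eq_one hδ hπ hm (x := 1) (by simp) (dvd_mul_right _ y)
        (isUnit_normForm_of_dvd hπ _ _ _ ((dvd_pow_self π (by omega)).mul_right _)) hz)
    rw [hΩ, ← hq] at this
    simpa using this
  suffices ∃ κ : ℂ,
      (0 < n → κ = 0) ∧
      (n = 0 → legendre F L ((b : F) ^ 2 - 4 * a * (c : 𝒪[F])) = -1 → κ = lam / (q + 1)) ∧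
      (n = 0 → legendre F L ((b : F) ^ 2 - 4 * a * (c : 𝒪[F])) = 0 →
        ∀ ϖL : Lˣ, IsUniformizer (integersOf F L) ϖL → κ = (Ω ϖL : ℂ)) ∧
      (n = 0 → legendre F L ((b : F) ^ 2 - 4 * a * (c : 𝒪[F])) = 1 →
        ∀ e : L ≃ₐ[F] F × F, κ = -(lam / (q - 1)) +
          q / (q - 1) * ((Ω (splitUnit e ϖ 1) : ℂ) + (Ω (splitUnit e 1 ϖ) : ℂ))) ∧
      q * β (n + 1) - lam * β n = -(κ * β n) by
    obtain ⟨κ, h1, h2, h3, h4, h5⟩ := this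
    exact ⟨κ, h1, h2, h3, h4, powerSeries_eq_of_recursion β n hq0 h5
      fun m hm => hrec m (by omega)⟩
  rcases Nat.eq_zero_or_pos n with hn0 | hn0
  swap
  · refine ⟨0, fun _ => rfl, by omega, by omega, by omega, ?_⟩
    obtain ⟨m, hm⟩ := Nat.exists_eq_succ_of_ne_zero hn0.ne'
    have h1 := hrec m hm.le
    have h2 : β m = 0 := h.apply_diagOne_eq_zero hδ hπ hπϖ hB hB₀ (by omega)
    rw [hm, Nat.succ_eq_add_one, h1, h2]
    ring
  have htriv : ∀ (x y : 𝒪[F]) (z : Lˣ), IsUnit (normForm a b c x y) →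
      (z : L) = thetaComb (b : F) δ x y → Ω z = 1 := fun x y z hN hz =>
    h.apply_eq_one hδ hπ (m := 0) (by omega) (by simp) (by simp) hN hz
  have hβ0 : β 0 = B₀ 1 := by
    simp only [hβ, pow_zero]
    congr 1
    ext i j
    rw [coe_diagOne]
    fin_cases i <;> fin_cases j <;> simp
  have hβ1 : β 1 = B₀ (diagOne ϖ) := by simp only [hβ, pow_one]
  rw [hn0, zero_add, hβ0, hβ1]
  simp only [lt_irrefl, false_imp_iff, forall_const, true_and]
  -- Needed to divide by q - 1 in the split case.
  have hq2 : (2 : ℝ) ≤ residueCard F := by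
    have : 1 < Nat.card 𝓀[F] := Finite.one_lt_card
    exact_mod_cast this
  by_cases hsq : IsSquare ((b : F) ^ 2 - 4 * a * (c : 𝒪[F]))
  · obtain ⟨u, hu⟩ := hunit hsq
    have hdu : IsUnit (b ^ 2 - 4 * a * c) := by
      convert u.isUnit
      apply Subtype.ext
      rw [hu]
      rfl
    obtain ⟨e₀, -, -⟩ := hL.split hsq
    refine ⟨-(lam / (q - 1)) +
      q / (q - 1) * ((Ω (splitUnit e₀ ϖ 1) : ℂ) + (Ω (splitUnit e₀ 1 ϖ) : ℂ)), ?_, ?_, ?_, ?_⟩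
    · simp [legendre, hsq]
    · simp [legendre, hsq]
    · intro _ e
      rcases splitUnit_eq_or_swap e e₀ with h1 | h1
      · rw [h1, h1]
      · rw [h1, h1, add_comm (Ω (splitUnit e₀ 1 ϖ) : ℂ)]
    · have h1 := hecke_zero_of_algEquiv hB hB₀ hδ h hπ hπϖ σ hσ hhecke htriv hdu e₀
      rw [← hq] at h1
      have hq1 : q - 1 ≠ 0 := by
        rw [hq, sub_ne_zero]
        intro h0
        have : (residueCard F : ℝ) = 1 := by exact_mod_cast h0
        linarith
      field_simp
      linear_combination (-q) * h1
  · by_cases hmax : (primeExt F L).IsMaximal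
    · refine ⟨lam / (q + 1), ?_, ?_, ?_, ?_⟩
      · simp
      · simp [legendre, hsq, hmax]
      · simp [legendre, hsq, hmax]
      · have h1 := hecke_zero_of_isMaximal hB hB₀ hδ h hπ hπϖ σ hσ hhecke htriv hmax
        rw [← hq] at h1
        have hq1 : q + 1 ≠ 0 := by
          rw [hq]
          exact_mod_cast (Nat.succ_pos (residueCard F)).ne'
        field_simp
        linear_combination (-q) * h1
    · obtain ⟨κ, hκ, h1⟩ := hecke_zero_of_not_isMaximal hB hB₀ hδ h hπ hπϖ σ hσ hhecke htriv hmax hsq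
      refine ⟨κ, ?_, fun _ => hκ, ?_, ?_⟩
      · simp [legendre, hsq, hmax]
      · simp [legendre, hsq, hmax]
      · rw [← hq] at h1
        linear_combination -h1
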